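/- For a finite simple graph $G$ on $n$ vertices let $d$, $\delta$ and $\Delta$ denote its average, minimum and maximum degree, and let $\lambda_1\ge\lambda_2\ge\dots\ge\lambda_n$ be the eigenvalues of its adjacency matrix, listed with multiplicity. Let $(G_k)_{k\ge 0}$ be a sequence of finite simple graphs, where $G_k$ has $n=n_k$ vertices and $n_k\to\infty$ as $k\to\infty$, and let $\lambda=\lambda(k)$ be real numbers such that every nontrivial eigenvalue of $G_k$ satisfies $|\lambda_i|\le\lambda$ $(2\le i\le n)$. Suppose that, with all parameters taken for $G_k$, 1. there is a constant $R>0$, independent of $k$, with $\Delta-\delta\le R\lambda$ for all $k$; 2. $\log^2 n=o(d/\lambda)$ as $k\to\infty$; 3. $\log n=o\bigl(\log d\cdot\log(d/\lambda)\bigr)$ as $k\to\infty$. Then the number of Hamilton cycles in $G_k$ (counted as subgraphs, without starting vertex or orientation) is $$n!\left(\frac dn\right)^n(1+o(1))^n\qquad(k\to\infty);$$ that is, there are real numbers $\varepsilon_k\to 0$ such that for all sufficiently large $k$ this number equals $n!\,(d/n)^n(1+\varepsilon_k)^n$. -/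

import Mathlib

open Filter Asymptotics
open scoped Topology Nat

namespace SimpleGraph

/-- The average degree `(∑ v, deg v) / |V|`. -/
noncomputable def avgDegree {V : Type*} [Fintype V] (G : SimpleGraph V)
    [DecidableRel G.Adj] : ℝ :=
  (∑ v, (G.degree v : ℝ)) / Fintype.card V

/-- With the adjacency eigenvalues `λ₁ ≥ λ₂ ≥ ⋯ ≥ λₙ` listed with multiplicity, all of
`λ₂, …, λₙ` are at most `lam` in absolute value. (`eigenvalues₀` is the decreasing list,
indexed from `0`.) -/
def NontrivialEigenvaluesLE {V : Type*} [Fintype V] [DecidableEq V] (G : SimpleGraph V)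
    [DecidableRel G.Adj] (lam : ℝ) : Prop :=
  ∀ i : Fin (Fintype.card V), (i : ℕ) ≠ 0 →
    |(G.isHermitian_adjMatrix ℝ).eigenvalues₀ i| ≤ lam

/-- The number of Hamilton cycles of `G`, as subgraphs (no starting vertex, no orientation). -/
noncomputable def numHamiltonCycles {V : Type*} [DecidableEq V] (G : SimpleGraph V) : ℕ :=
  Set.ncard {H : G.Subgraph | ∃ (v : V) (p : G.Walk v v),
    p.IsHamiltonianCycle ∧ p.toSubgraph = H}

end SimpleGraph

/-! By the expander mixing lemma (`NontrivialEigenvaluesLE.mixing`), near-regularity and the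
eigenvalue bound give e(S,T) = d|S||T|/n up to μ√(|S||T|), with μ = (1+8R)λ. Everything after that
uses only this and a minimum degree of at least d/4.

Counting. Partition the vertices into j oriented paths. Joining two paths of a (j+1)-family along an
edge gives a j-family, and each j-family arises from exactly n-j cuts (`sum_card_merges`). The joins
are essentially the edges between the last and the first vertices, two sets of size j+1, so there
are about d(j+1)²/n of them. Descending from the single family of n one-vertex paths, the number of
j-families is about C(n,j)∏_{j<i≤n} di/n, with an additive error of order μ in each factor. For j =
1 this is the upper bound. For the lower bound the factors are under control only while di/n is much
larger than μ, so the descent stops at m ≈ n√ρ/log² n paths, where ρ = μ log² n/d → 0.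

From families to cycles. Concatenating m paths gives an ordering of the vertices with at most m
non-edges. Pósa rotations (`Mixing.exists_adj_ends`) make the ends of any ordering adjacent at the
cost of O(log n) new pairs, all of them edges. Closing up and cutting at a non-edge removes that
non-edge, so within m+1 rounds the ordering follows a Hamilton cycle and has changed in O(m log n)
pairs (`exists_cyclicOrdering`). An ordering is determined by its first vertex and its set of pairs,
so each Hamilton cycle accounts for at most exp(O(m log² n)) = exp(o(n)) families.

The delicate point is to rotate both ends, since rotating one end disturbs the path for the other.
The ordering is divided into 2T+2 blocks, where 2^T ≥ n. Each block has a core of almost all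
vertices, from which an end can be rotated with pivots in that block and endpoints in the core
(`Mixing.exists_core`). At most 2T rotations bring both ends into all cores and spoil at most 2T
blocks. The ordering is then cut between two surviving blocks, and each end is rotated on its own
side. Both sets of reachable endpoints are large, so some edge joins them. -/

set_option linter.unusedSectionVars false
set_option linter.unusedVariables false

/-! ### Vertex lists as paths: consecutive pairs and surviving blocks -/

namespace List

variable {V : Type*} [DecidableEq V]

/-- The unordered pairs of consecutive entries of a list. -/
def pathEdges : List V → Finset (Sym2 V)
  | [] => ∅
  | [_] => ∅
  | a :: b :: l => insert s(a, b) (pathEdges (b :: l))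

@[simp] lemma pathEdges_nil : ([] : List V).pathEdges = ∅ := rfl

@[simp] lemma pathEdges_singleton (a : V) : [a].pathEdges = ∅ := rfl

lemma mem_pathEdges_cons {e : Sym2 V} {a : V} {l : List V} :
    e ∈ (a :: l).pathEdges ↔ e ∈ l.pathEdges ∨ ∃ y ∈ l.head?, e = s(a, y) := by
  cases l with
  | nil => simp
  | cons b l => simp [pathEdges, or_comm]

lemma mem_pathEdges_append {e : Sym2 V} {A B : List V} :
    e ∈ (A ++ B).pathEdges ↔ e ∈ A.pathEdges ∨ e ∈ B.pathEdges ∨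
      ∃ x ∈ A.getLast?, ∃ y ∈ B.head?, e = s(x, y) := by
  induction A with
  | nil => simp
  | cons a A ih =>
    rw [cons_append, mem_pathEdges_cons, ih, mem_pathEdges_cons]
    cases A with
    | nil => simp
    | cons b A =>
      rw [getLast?_cons_cons]
      simp only [cons_append, head?_cons, Option.mem_some_iff, exists_eq_left', or_assoc]
      exact or_congr_right (by rw [or_comm, or_assoc]; exact or_rotate)

@[simp] lemma pathEdges_reverse (l : List V) : l.reverse.pathEdges = l.pathEdges := by
  induction l with
  | nil => rfl
  | cons a l ih =>
    ext e
    rw [reverse_cons, mem_pathEdges_append, mem_pathEdges_cons, ih]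
    simp [mem_pathEdges_cons, Sym2.eq_swap]

lemma mem_of_mem_pathEdges {l : List V} {e : Sym2 V} (he : e ∈ l.pathEdges) {x : V} (hx : x ∈ e) :
    x ∈ l := by
  induction l with
  | nil => simp at he
  | cons a l ih =>
    rw [mem_pathEdges_cons] at he
    rcases he with he | ⟨y, hy, rfl⟩
    · exact mem_cons_of_mem _ (ih he)
    · rcases Sym2.mem_iff.1 hx with rfl | rfl
      · simp
      · exact mem_cons_of_mem _ (mem_of_mem_head? hy)

lemma card_pathEdges {l : List V} (hl : l.Nodup) : l.pathEdges.card = l.length - 1 := by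
  induction l with
  | nil => rfl
  | cons a l ih =>
    cases l with
    | nil => rfl
    | cons b l =>
      rw [pathEdges, Finset.card_insert_of_notMem, ih hl.of_cons]
      · simp
      · intro h
        exact (nodup_cons.1 hl).1 (mem_of_mem_pathEdges h (Sym2.mem_mk_left a b))

lemma mem_pathEdges_iff_of_nodup {A B : List V} {z w : V} (h : (A ++ z :: B).Nodup) :
    s(z, w) ∈ (A ++ z :: B).pathEdges ↔ A.getLast? = some w ∨ B.head? = some w := by
  have hA : z ∉ A := fun hz => by grind
  have hB : z ∉ B := fun hz => by grind
  rw [mem_pathEdges_append, mem_pathEdges_cons]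
  constructor
  · rintro (h | (h | ⟨y, hy, he⟩) | ⟨x, hx, y, hy, he⟩)
    · exact absurd (mem_of_mem_pathEdges h (Sym2.mem_mk_left _ _)) hA
    · exact absurd (mem_of_mem_pathEdges h (Sym2.mem_mk_left _ _)) hB
    · rw [Sym2.congr_right] at he
      subst he; exact Or.inr hy
    · simp only [head?_cons, Option.mem_def, Option.some.injEq] at hy
      subst hy
      rw [Sym2.eq_swap, Sym2.congr_left] at he
      subst he; exact Or.inl hx
  · rintro (h | h)
    · exact Or.inr (Or.inr ⟨w, h, z, by simp, Sym2.eq_swap⟩)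
    · exact Or.inr (Or.inl (Or.inr ⟨w, h, rfl⟩))

lemma card_filter_mem_pathEdges_le_two [Fintype V] {l : List V} (hl : l.Nodup) (z : V) :
    (Finset.univ.filter fun w => s(z, w) ∈ l.pathEdges).card ≤ 2 := by
  by_cases hz : z ∈ l
  · obtain ⟨A, B, rfl⟩ := append_of_mem hz
    calc _ ≤ (A.getLast?.toFinset ∪ B.head?.toFinset).card := by
            apply Finset.card_le_card
            intro w hw
            simpa [mem_pathEdges_iff_of_nodup hl] using hw
      _ ≤ A.getLast?.toFinset.card + B.head?.toFinset.card := Finset.card_union_le _ _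
      _ ≤ 1 + 1 := by
            gcongr
            · cases A.getLast? <;> simp
            · cases B.head? <;> simp
  · rw [Finset.filter_false_of_mem]
    · simp
    · intro w _ h
      exact hz (mem_of_mem_pathEdges h (Sym2.mem_mk_left _ _))

/-- A nonempty duplicate-free list is determined by its head and its consecutive pairs. -/
lemma eq_of_head_eq_of_pathEdges_eq {l l' : List V} (hl : l.Nodup) (hl' : l'.Nodup)
    (hh : l.head? = l'.head?) (he : l.pathEdges = l'.pathEdges) : l = l' := by
  induction l generalizing l' with
  | nil => cases l' <;> simp_all
  | cons a l ih =>
    cases l' with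
    | nil => simp at hh
    | cons a' l' =>
      simp only [head?_cons, Option.some.injEq] at hh
      subst hh
      have key : ∀ w, l.head? = some w ↔ l'.head? = some w := by
        intro w
        have h1 := mem_pathEdges_iff_of_nodup (A := []) (w := w) hl
        have h2 := mem_pathEdges_iff_of_nodup (A := []) (w := w) hl'
        simp only [nil_append, getLast?_nil, reduceCtorEq, false_or] at h1 h2
        rw [← h1, ← h2, he]
      have hhd : l.head? = l'.head? := Option.ext key
      congr 1
      refine ih hl.of_cons hl'.of_cons hhd ?_
      ext e
      -- The pairs of the tail are those pairs of the whole list that avoid its head, so they are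
      -- determined too.
      have h : ∀ {k : List V}, (a :: k).Nodup →
          (e ∈ k.pathEdges ↔ e ∈ (a :: k).pathEdges ∧ a ∉ e) := by
        intro k hk
        rw [mem_pathEdges_cons]
        constructor
        · intro h
          exact ⟨Or.inl h, fun ha => (nodup_cons.1 hk).1 (mem_of_mem_pathEdges h ha)⟩
        · rintro ⟨h | ⟨y, -, rfl⟩, ha⟩
          · exact h
          · simp at ha
      rw [h hl, h hl', he]

/-- In a duplicate-free list, an interior entry of a contiguous block has both its neighbours in
the block. -/
lemma mem_pathEdges_of_infix {J l : List V} (hJ : J <:+: l) (hl : l.Nodup) {w z : V} (hw : w ∈ J)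
    (hh : J.head? ≠ some w) (ht : J.getLast? ≠ some w) (h : s(w, z) ∈ l.pathEdges) :
    s(w, z) ∈ J.pathEdges := by
  obtain ⟨A, B, rfl⟩ := hJ
  obtain ⟨C, D, rfl⟩ := append_of_mem hw
  have hC : C ≠ [] := by rintro rfl; simp at hh
  have hD : D ≠ [] := by rintro rfl; simp at ht
  have e : A ++ (C ++ w :: D) ++ B = (A ++ C) ++ w :: (D ++ B) := by simp
  rw [e] at hl h
  rw [mem_pathEdges_iff_of_nodup hl] at h
  rw [mem_pathEdges_iff_of_nodup (by
    refine hl.sublist ?_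
    exact Sublist.append (sublist_append_right _ _) ((sublist_append_left _ _).cons_cons _))]
  rwa [getLast?_append_of_ne_nil _ hC, head?_append_of_ne_nil _ hD] at h

/-- A block straddling the cut contains the pair at the cut. Hence a rotation can destroy a block
only by breaking one particular pair. -/
lemma infix_append_cases {J A B : List V} (h : J <:+: A ++ B) :
    J <:+: A ∨ J <:+: B ∨ ∃ x ∈ A.getLast?, ∃ y ∈ B.head?, s(x, y) ∈ J.pathEdges := by
  rw [infix_append_iff_ne_nil] at h
  rcases h with h | h | ⟨l₁, l₂, hl₁, hl₂, rfl, hs, hp⟩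
  · exact Or.inl h
  · exact Or.inr (Or.inl h)
  · refine Or.inr (Or.inr ⟨l₁.getLast hl₁, ?_, l₂.head hl₂, ?_, ?_⟩)
    · obtain ⟨t, rfl⟩ := hs
      rw [getLast?_append_of_ne_nil _ hl₁, getLast?_eq_getLast_of_ne_nil hl₁]; rfl
    · obtain ⟨t, rfl⟩ := hp
      rw [head?_append_of_ne_nil _ hl₂, head?_eq_some_head hl₂]; rfl
    · rw [mem_pathEdges_append]
      exact Or.inr (Or.inr ⟨_, by rw [getLast?_eq_getLast_of_ne_nil hl₁]; rfl, _,
        by rw [head?_eq_some_head hl₂]; rfl, rfl⟩)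

/-- `J` is a contiguous block of `l`, possibly traversed backwards. -/
def Intact (J l : List V) : Prop := J <:+: l ∨ J.reverse <:+: l

lemma Intact.reverse {J l : List V} (h : Intact J l) : Intact J l.reverse := by
  rcases h with h | h
  · exact Or.inr (reverse_infix.2 h)
  · left; rw [← reverse_infix]; simpa using h

lemma Intact.append_cases {J A B : List V} (h : Intact J (A ++ B)) :
    Intact J A ∨ Intact J B ∨ ∃ x ∈ A.getLast?, ∃ y ∈ B.head?, s(x, y) ∈ J.pathEdges := by
  rcases h with h | h
  · rcases infix_append_cases h with h | h | h
    · exact Or.inl (Or.inl h)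
    · exact Or.inr (Or.inl (Or.inl h))
    · exact Or.inr (Or.inr h)
  · rcases infix_append_cases h with h | h | h
    · exact Or.inl (Or.inr h)
    · exact Or.inr (Or.inl (Or.inr h))
    · rw [pathEdges_reverse] at h
      exact Or.inr (Or.inr h)

lemma Intact.append_left {J A : List V} (h : Intact J A) (B : List V) : Intact J (A ++ B) := by
  rcases h with h | h
  · exact Or.inl (infix_append_of_infix_left h)
  · exact Or.inr (infix_append_of_infix_left h)

lemma Intact.append_right {J B : List V} (h : Intact J B) (A : List V) : Intact J (A ++ B) := by
  rcases h with h | h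
  · exact Or.inl (infix_append_of_infix_right h)
  · exact Or.inr (infix_append_of_infix_right h)

lemma Intact.mem {J l : List V} (h : Intact J l) {x : V} (hx : x ∈ J) : x ∈ l := by
  rcases h with h | h
  · exact h.subset hx
  · exact h.subset (by simpa using hx)

lemma Intact.mem_pathEdges {J l : List V} (h : Intact J l) (hl : l.Nodup) {w z : V} (hw : w ∈ J)
    (hh : J.head? ≠ some w) (ht : J.getLast? ≠ some w) (he : s(w, z) ∈ l.pathEdges) :
    s(w, z) ∈ J.pathEdges := by
  rcases h with h | h
  · exact mem_pathEdges_of_infix h hl hw hh ht he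
  · rw [← pathEdges_reverse]
    exact mem_pathEdges_of_infix h hl (by simpa using hw) (by simpa using ht) (by simpa using hh) he

/-- Two disjoint nonempty blocks of a list can be separated by cutting the list once. -/
lemma Intact.exists_append {J K l : List V} (hJ : Intact J l) (hK : Intact K l)
    (hJ0 : J ≠ []) (hJK : J.Disjoint K) :
    ∃ A B, l = A ++ B ∧ (Intact J A ∧ Intact K B ∨ Intact K A ∧ Intact J B) := by
  -- `J'` is the orientation of `J` that occurs in `l`. `K` cannot straddle either boundary of `J'`,
  -- since the pair there would put an entry of `J` into `K`.
  obtain ⟨J', hJ', A, B, hAB⟩ : ∃ J', (J' = J ∨ J' = J.reverse) ∧ J' <:+: l := by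
    rcases hJ with h | h
    exacts [⟨J, Or.inl rfl, h⟩, ⟨_, Or.inr rfl, h⟩]
  have hmem : ∀ x, x ∈ J' ↔ x ∈ J := by rcases hJ' with rfl | rfl <;> simp
  have hne : J' ≠ [] := by rcases hJ' with rfl | rfl <;> simpa
  have hJ'i : Intact J J' := by
    rcases hJ' with rfl | rfl
    · exact Or.inl infix_rfl
    · exact Or.inr infix_rfl
  subst hAB
  rcases hK.append_cases with h | h | ⟨x, hx, y, hy, hxy⟩
  · rcases h.append_cases with h | h | ⟨x, hx, y, hy, hxy⟩
    · exact ⟨A, J' ++ B, by simp, Or.inr ⟨h, hJ'i.append_left _⟩⟩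
    · have hK0 : K = [] := by
        rw [eq_nil_iff_forall_not_mem]
        intro x hx
        exact hJK ((hmem x).1 (h.mem hx)) hx
      subst hK0
      exact ⟨A ++ J', B, by simp, Or.inl ⟨hJ'i.append_right _, Or.inl (nil_infix)⟩⟩
    · exact absurd (mem_of_mem_pathEdges hxy (Sym2.mem_mk_right _ _))
        (hJK ((hmem y).1 (mem_of_mem_head? hy)))
  · exact ⟨A ++ J', B, by simp, Or.inl ⟨hJ'i.append_right _, h⟩⟩
  · rw [getLast?_append_of_ne_nil _ hne] at hx
    exact absurd (mem_of_mem_pathEdges hxy (Sym2.mem_mk_left _ _))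
        (hJK ((hmem x).1 (mem_of_mem_getLast? hx)))

end List

/-! ### Reroutings and the Pósa rotation -/

namespace SimpleGraph

variable {V : Type*} [DecidableEq V]

/-- `l'` is a reordering of `l` in which at most `t` consecutive pairs are new, all new ones are
edges of `G`, and every block of `l` survives unless it meets one of at most `t` pairs. -/
structure Rerouted (G : SimpleGraph V) (t : ℕ) (l l' : List V) : Prop where
  perm : l'.Perm l
  card_sdiff : (l'.pathEdges \ l.pathEdges).card ≤ t
  adj : ∀ e ∈ l'.pathEdges, e ∈ l.pathEdges ∨ e ∈ G.edgeSet
  intact : ∃ D : Finset (Sym2 V), D.card ≤ t ∧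
    ∀ J, List.Intact J l → Disjoint D J.pathEdges → List.Intact J l'

variable {G : SimpleGraph V}

lemma Rerouted.refl (l : List V) : G.Rerouted 0 l l :=
  ⟨.refl _, by simp, fun _ h => Or.inl h, ∅, by simp, fun _ h _ => h⟩

lemma card_sdiff_le_add {α : Type*} [DecidableEq α] (A B C : Finset α) :
    (A \ C).card ≤ (B \ C).card + (A \ B).card :=
  (Finset.card_le_card (fun x hx => by
    simp only [Finset.mem_sdiff, Finset.mem_union] at *; tauto)).trans (Finset.card_union_le _ _)

lemma Rerouted.trans {s t : ℕ} {l l' l'' : List V} (h : G.Rerouted s l l')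
    (h' : G.Rerouted t l' l'') : G.Rerouted (s + t) l l'' := by
  obtain ⟨D, hD, hD'⟩ := h.intact
  obtain ⟨E, hE, hE'⟩ := h'.intact
  refine ⟨h'.perm.trans h.perm, ?_, ?_, D ∪ E, ?_, ?_⟩
  · exact (card_sdiff_le_add _ l'.pathEdges _).trans (add_le_add h.card_sdiff h'.card_sdiff)
  · intro e he
    rcases h'.adj e he with he | he
    · exact h.adj e he
    · exact Or.inr he
  · exact (Finset.card_union_le _ _).trans (add_le_add hD hE)
  · intro J hJ hd
    rw [Finset.disjoint_union_left] at hd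
    exact hE' J (hD' J hJ hd.1) hd.2

lemma Rerouted.reverse {t : ℕ} {l l' : List V} (h : G.Rerouted t l l') :
    G.Rerouted t l.reverse l'.reverse := by
  obtain ⟨D, hD, hD'⟩ := h.intact
  refine ⟨?_, by simpa using h.card_sdiff, by simpa using h.adj, D, hD, ?_⟩
  · exact (List.reverse_perm _).trans (h.perm.trans (List.reverse_perm _).symm)
  · intro J hJ hd
    refine (hD' J ?_ hd).reverse
    simpa using hJ.reverse

lemma Rerouted.mono {s t : ℕ} {l l' : List V} (h : G.Rerouted s l l') (hst : s ≤ t) :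
    G.Rerouted t l l' := by
  obtain ⟨D, hD, hD'⟩ := h.intact
  exact ⟨h.perm, h.card_sdiff.trans hst, h.adj, D, hD.trans hst, hD'⟩

/-- A single Pósa rotation: reverse the final segment `B` of `A ++ B`. -/
lemma Rerouted.rotation {A B : List V} {w y : V} (hw : w ∈ A.getLast?) (hy : y ∈ B.getLast?)
    (hwy : G.Adj w y) : G.Rerouted 1 (A ++ B) (A ++ B.reverse) := by
  have hsub : ∀ e ∈ (A ++ B.reverse).pathEdges, e ∈ (A ++ B).pathEdges ∨ e = s(w, y) := by
    intro e he
    rw [List.mem_pathEdges_append] at he ⊢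
    rcases he with he | he | ⟨x, hx, z, hz, rfl⟩
    · tauto
    · rw [List.pathEdges_reverse] at he; tauto
    · rw [List.head?_reverse] at hz
      right
      rw [Option.mem_unique hx hw, Option.mem_unique hz hy]
  refine ⟨(List.reverse_perm B).append_left A, ?_, ?_, ?_⟩
  · calc _ ≤ ({s(w, y)} : Finset (Sym2 V)).card := by
            apply Finset.card_le_card
            intro e he
            rw [Finset.mem_sdiff] at he
            simpa [he.2] using hsub e he.1
      _ = 1 := by simp
  · intro e he
    rcases hsub e he with h | rfl
    · exact Or.inl h
    · exact Or.inr hwy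
  · have hB : B ≠ [] := by rintro rfl; simp at hy
    -- The only old pair that the rotation can break is the one at the cut.
    refine ⟨{s(w, B.head hB)}, by simp, ?_⟩
    intro J hJ hd
    rcases hJ.append_cases with h | h | ⟨x, hx, z, hz, hxz⟩
    · exact h.append_left _
    · exact h.reverse.append_right _
    · rw [Finset.disjoint_singleton_left] at hd
      rw [Option.mem_unique hx hw] at hxz
      rw [List.head?_eq_some_head hB] at hz
      rw [Option.mem_some_iff] at hz
      subst hz
      exact absurd hxz hd

end SimpleGraph

/-! ### Growth of the set of endpoints under rotations -/

namespace SimpleGraph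

variable {V : Type*} [DecidableEq V] [Fintype V]

/-- The conclusion of the expander mixing lemma with density `d / |V|` and error `μ`. -/
def Mixing (G : SimpleGraph V) [DecidableRel G.Adj] (d μ : ℝ) : Prop :=
  ∀ S T : Finset V, |((G.interedges S T).card : ℝ) - d * S.card * T.card / Fintype.card V| ≤
    μ * √(S.card * T.card)

variable {G : SimpleGraph V} [DecidableRel G.Adj] {d μ q : ℝ}

lemma card_interedges_eq_sum (S T : Finset V) :
    (G.interedges S T).card = ∑ v ∈ S, (T.filter (G.Adj v)).card := by
  simp only [interedges, Rel.interedges, Finset.card_filter, Finset.sum_product]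

lemma Mixing.le (h : G.Mixing d μ) (S T : Finset V) :
    ((G.interedges S T).card : ℝ) ≤ d * S.card * T.card / Fintype.card V +
      μ * √(S.card * T.card) := by
  have := (abs_le.1 (h S T)).2
  linarith

lemma Mixing.ge (h : G.Mixing d μ) (S T : Finset V) :
    d * S.card * T.card / Fintype.card V - μ * √(S.card * T.card) ≤
      ((G.interedges S T).card : ℝ) := by
  have := (abs_le.1 (h S T)).1
  linarith

/-- Small sets all of whose vertices have many neighbours in `U` expand into `U`. -/
lemma Mixing.seven_mul_card_le (h : G.Mixing d μ) (hμ : 0 ≤ μ) (hd : 0 < d) (hq : 6 * μ ≤ q)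
    {S U : Finset V} (hS : ∀ v ∈ S, q ≤ (U.filter (G.Adj v)).card)
    (hcard : 14 * d * S.card ≤ q * Fintype.card V) :
    7 * S.card ≤ (U.filter fun w => ∃ v ∈ S, G.Adj v w).card := by
  rcases S.eq_empty_or_nonempty with rfl | hne
  · simp
  by_contra! hlt
  set W := U.filter fun w => ∃ v ∈ S, G.Adj v w
  have hSpos : (0 : ℝ) < S.card := by exact_mod_cast hne.card_pos
  have hn : (0 : ℝ) < Fintype.card V := by
    obtain ⟨v, -⟩ := hne
    exact_mod_cast Fintype.card_pos_iff.2 ⟨v⟩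
  have h1 : q * S.card ≤ (G.interedges S W).card := by
    rw [card_interedges_eq_sum]
    push_cast
    calc q * S.card = ∑ v ∈ S, q := by simp [mul_comm]
      _ ≤ _ := by
        apply Finset.sum_le_sum
        intro v hv
        refine (hS v hv).trans ?_
        norm_cast
        apply Finset.card_le_card
        intro w hw
        simp only [Finset.mem_filter, W] at hw ⊢
        exact ⟨⟨hw.1, v, hv, hw.2⟩, hw.2⟩
  have hW : (W.card : ℝ) < 7 * S.card := by exact_mod_cast hlt
  -- Since |W| < 7|S|, the hypothesis 14d|S| ≤ qn bounds the main term by q|S|/2, and √7 < 3 with 6μ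
  -- ≤ q bounds the error term by q|S|/2.
  have h2 := h.le S W
  have h3 : √((S.card : ℝ) * W.card) ≤ 3 * S.card := by
    rw [Real.sqrt_le_left (by positivity)]
    nlinarith
  have h4 : d * S.card * W.card / Fintype.card V < q / 2 * S.card := by
    rw [div_lt_iff₀ hn]
    have : d * S.card * W.card < d * S.card * (7 * S.card) :=
      mul_lt_mul_of_pos_left hW (by positivity)
    nlinarith
  have h5 : μ * √((S.card : ℝ) * W.card) ≤ q / 2 * S.card := by
    have := mul_le_mul_of_nonneg_left h3 hμ
    nlinarith
  linarith

/-- Away from `S` and its neighbours in `l`, the list `l'` has only neighbour pairs of `l`. -/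
def UnchangedOff (S : Finset V) (l l' : List V) : Prop :=
  ∀ w, w ∉ S → (∀ z, s(w, z) ∈ l.pathEdges → z ∉ S) → ∀ z, s(w, z) ∈ l'.pathEdges →
    s(w, z) ∈ l.pathEdges

/-- The endpoint `v` is reached from `l` by at most `t` rotations with endpoints in `S`. -/
def RotatesTo (G : SimpleGraph V) (S : Finset V) (t : ℕ) (l : List V) (v : V) : Prop :=
  ∃ l', G.Rerouted t l l' ∧ l'.head? = l.head? ∧ l'.getLast? = some v ∧ UnchangedOff S l l'

/-- Rotating at the pivot `w` makes the successor of `w` in the current list the new endpoint. As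
`w` is neither in `S` nor next to `S` in `l`, that successor is one of its neighbours in `l`,
whatever rotations came before. -/
lemma RotatesTo.step {S : Finset V} {t : ℕ} {l : List V} (hl : l.Nodup) {v w : V}
    (h : G.RotatesTo S t l v) (hv : v ∈ S) (hw : w ∉ S)
    (hw' : ∀ z, s(w, z) ∈ l.pathEdges → z ∉ S) (hwl : w ∈ l) (hvw : G.Adj v w) :
    ∃ z, s(w, z) ∈ l.pathEdges ∧ ∀ S', S ⊆ S' → z ∈ S' → G.RotatesTo S' (t + 1) l z := by
  obtain ⟨l', hr, hh, hlast, hun⟩ := h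
  obtain ⟨A, B, rfl⟩ := List.append_of_mem (hr.perm.mem_iff.2 hwl)
  cases B with
  | nil =>
    simp only [List.getLast?_append, List.getLast?_singleton, Option.some_or,
      Option.some.injEq] at hlast
    exact absurd (hlast ▸ hv) hw
  | cons z B =>
    have hwz : s(w, z) ∈ l.pathEdges := by
      refine hun w hw hw' z ?_
      rw [List.mem_pathEdges_iff_of_nodup (hr.perm.nodup_iff.2 hl)]
      simp
    have hvB : v ∈ (z :: B).getLast? := by
      rw [List.getLast?_append_of_ne_nil _ (by simp), List.getLast?_cons_cons] at hlast
      exact hlast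
    have hrot : G.Rerouted 1 ((A ++ [w]) ++ z :: B) ((A ++ [w]) ++ (z :: B).reverse) :=
      Rerouted.rotation (w := w) (by simp) hvB hvw.symm
    refine ⟨z, hwz, fun S' hS' hz => ⟨(A ++ [w]) ++ (z :: B).reverse, ?_, ?_, ?_, ?_⟩⟩
    · refine hr.trans ?_
      simpa using hrot
    · rw [← hh, List.head?_append_of_ne_nil _ (by simp)]
      cases A <;> simp
    · rw [List.getLast?_append_of_ne_nil _ (by simp)]
      simp
    · intro x hx hx' y hxy
      have hcase : s(x, y) ∈ (A ++ w :: z :: B).pathEdges ∨ s(x, y) = s(w, v) := by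
        have e : A ++ w :: z :: B = (A ++ [w]) ++ z :: B := by simp
        rw [e, List.mem_pathEdges_append]
        rw [List.mem_pathEdges_append, List.pathEdges_reverse, List.head?_reverse] at hxy
        rcases hxy with h | h | ⟨a, ha, b, hb, hab⟩
        · exact Or.inl (Or.inl h)
        · exact Or.inl (Or.inr (Or.inl h))
        · right
          rw [hab, Option.mem_unique hb hvB]
          simp only [List.getLast?_append, List.getLast?_singleton, Option.some_or,
            Option.mem_some_iff] at ha
          rw [ha]
      -- The only new pair joins `w` and `v`. Both are exempt: `w` is next to `z` in `l` with `z ∈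
      -- S'`, and `v` lies in `S'`.
      rcases hcase with h | h
      · exact hun x (fun h => hx (hS' h)) (fun z hz hzS => hx' z hz (hS' hzS)) y h
      · rcases Sym2.eq_iff.1 h with ⟨rfl, rfl⟩ | ⟨rfl, rfl⟩
        · exact absurd hz (hx' z hwz)
        · exact absurd (hS' hv) hx

lemma RotatesTo.mono {S S' : Finset V} {t t' : ℕ} {l : List V} {v : V}
    (h : G.RotatesTo S t l v) (hS : S ⊆ S') (ht : t ≤ t') : G.RotatesTo S' t' l v := by
  obtain ⟨l', hr, hh, hlast, hun⟩ := h
  exact ⟨l', hr.mono ht, hh, hlast, fun w hw hw' => hun w (fun h => hw (hS h))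
    (fun z hz hzS => hw' z hz (hS hzS))⟩

/-- One round of rotations at least doubles a small set of endpoints. -/
lemma Mixing.exists_double (h : G.Mixing d μ) (hμ : 0 ≤ μ) (hd : 0 < d) (hq : 6 * μ ≤ q)
    {l : List V} (hl : l.Nodup) {X U : Finset V}
    (hX : ∀ v ∈ X, q ≤ (U.filter (G.Adj v)).card) (hUl : ∀ w ∈ U, w ∈ l)
    (hUX : ∀ w ∈ U, ∀ z, s(w, z) ∈ l.pathEdges → z ∈ X) {S : Finset V} {t : ℕ} (hSX : S ⊆ X)
    (hS : ∀ v ∈ S, G.RotatesTo S t l v) (hcard : 14 * d * S.card ≤ q * Fintype.card V) :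
    ∃ S' : Finset V, S' ⊆ X ∧ 2 * S.card ≤ S'.card ∧ ∀ v ∈ S', G.RotatesTo S' (t + 1) l v := by
  have h7 := h.seven_mul_card_le hμ hd hq (fun v hv => hX v (hSX hv)) hcard
  set W := U.filter fun w => ∃ v ∈ S, G.Adj v w
  set N : Finset V := S.biUnion fun z => Finset.univ.filter fun w => s(z, w) ∈ l.pathEdges
  have hN : N.card ≤ S.card * 2 :=
    Finset.card_biUnion_le_card_mul _ _ _ fun z _ => List.card_filter_mem_pathEdges_le_two hl z
  -- At most |S| + 2|S| of the 7|S| candidate pivots lie in `S` or next to it on `l`, which leaves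
  -- 4|S|. Each endpoint comes from at most two pivots, so there are at least 2|S| endpoints.
  set W' := W \ (S ∪ N)
  have hW' : 4 * S.card ≤ W'.card := by
    have h1 : W.card - (S ∪ N).card ≤ W'.card := Finset.le_card_sdiff _ _
    have h2 := Finset.card_union_le S N
    omega
  have hstep : ∀ w ∈ W', ∃ z, s(w, z) ∈ l.pathEdges ∧
      ∀ S', S ⊆ S' → z ∈ S' → G.RotatesTo S' (t + 1) l z := by
    intro w hw
    simp only [W', Finset.mem_sdiff, Finset.mem_union, not_or, W, Finset.mem_filter] at hw
    obtain ⟨⟨hwU, v, hvS, hvw⟩, hwS, hwN⟩ := hw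
    refine (hS v hvS).step hl hvS hwS ?_ (hUl w hwU) hvw
    intro z hz hzS
    refine hwN (Finset.mem_biUnion.2 ⟨z, hzS, ?_⟩)
    rw [Sym2.eq_swap] at hz
    simpa using hz
  choose! f hf hf' using hstep
  have him : W'.card ≤ 2 * (W'.image f).card := by
    refine Finset.card_le_mul_card_image W' 2 fun z _ => ?_
    refine (Finset.card_le_card ?_).trans (List.card_filter_mem_pathEdges_le_two hl z)
    intro w hw
    simp only [Finset.mem_filter] at hw
    have := hf w hw.1
    rw [hw.2, Sym2.eq_swap] at this
    simpa using this
  refine ⟨S ∪ W'.image f, ?_, ?_, ?_⟩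
  · refine Finset.union_subset hSX ?_
    intro z hz
    obtain ⟨w, hw, rfl⟩ := Finset.mem_image.1 hz
    refine hUX w ?_ _ (hf w hw)
    simp only [W', Finset.mem_sdiff, W, Finset.mem_filter] at hw
    exact hw.1.1
  · have := Finset.card_le_card (Finset.subset_union_right (s₁ := S) (s₂ := W'.image f))
    omega
  · intro v hv
    rcases Finset.mem_union.1 hv with hv' | hv'
    · exact (hS v hv').mono Finset.subset_union_left (Nat.le_succ t)
    · obtain ⟨w, hw, rfl⟩ := Finset.mem_image.1 hv'
      exact hf' w hw _ Finset.subset_union_left hv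

/-- Repeated rotations reach linearly many endpoints within `T` rounds once `|V| ≤ 2 ^ T`. -/
lemma Mixing.exists_endpoints (h : G.Mixing d μ) (hμ : 0 ≤ μ) (hd : 0 < d) (hq : 6 * μ ≤ q)
    (hqd : q ≤ d) {T : ℕ} (hT : Fintype.card V ≤ 2 ^ T) {l : List V} (hl : l.Nodup)
    {X U : Finset V}
    (hX : ∀ v ∈ X, q ≤ (U.filter (G.Adj v)).card) (hUl : ∀ w ∈ U, w ∈ l)
    (hUX : ∀ w ∈ U, ∀ z, s(w, z) ∈ l.pathEdges → z ∈ X) {y : V} (hy : l.getLast? = some y)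
    (hyX : y ∈ X) :
    ∃ S : Finset V, S ⊆ X ∧ q * Fintype.card V ≤ 14 * d * S.card ∧
      ∀ v ∈ S, ∃ l', G.Rerouted T l l' ∧ l'.head? = l.head? ∧ l'.getLast? = some v := by
  have key : ∀ t, ∃ S : Finset V, S ⊆ X ∧
      (q * Fintype.card V ≤ 14 * d * S.card ∨ 2 ^ t ≤ S.card) ∧
      ∀ v ∈ S, G.RotatesTo S t l v := by
    intro t
    induction t with
    | zero =>
      refine ⟨{y}, by simpa using hyX, Or.inr (by simp), ?_⟩
      intro v hv
      rw [Finset.mem_singleton] at hv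
      subst hv
      exact ⟨l, Rerouted.refl l, rfl, hy, fun _ _ _ _ h => h⟩
    | succ t ih =>
      obtain ⟨S, hSX, hS, hSr⟩ := ih
      by_cases hbig : q * Fintype.card V ≤ 14 * d * S.card
      · exact ⟨S, hSX, Or.inl hbig, fun v hv => (hSr v hv).mono subset_rfl (Nat.le_succ t)⟩
      · obtain ⟨S', hS'X, hS', hSr'⟩ := h.exists_double hμ hd hq hl hX hUl hUX hSX hSr
          (not_le.1 hbig).le
        refine ⟨S', hS'X, Or.inr ?_, hSr'⟩
        have := hS.resolve_left hbig
        rw [pow_succ]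
        omega
  obtain ⟨S, hSX, hS, hSr⟩ := key T
  refine ⟨S, hSX, ?_, fun v hv => ?_⟩
  · rcases hS with hS | hS
    · exact hS
    -- Here doubling has exhausted the vertex set, and q ≤ d makes n endpoints more than enough.
    · have hn : (Fintype.card V : ℝ) ≤ S.card := by exact_mod_cast hT.trans hS
      have : q * (Fintype.card V : ℝ) ≤ d * S.card := by gcongr
      have h0 : 0 ≤ d * S.card := by positivity
      linarith
  · obtain ⟨l', hr, hh, hlast, -⟩ := hSr v hv
    exact ⟨l', hr, hh, hlast⟩

end SimpleGraph

/-! ### Blocks, their cores, and making the two ends adjacent -/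

namespace List

variable {V : Type*} [DecidableEq V] [Fintype V]

/-- The interior entries of `J` both of whose neighbours in `J` lie in `X`. -/
def inner (J : List V) (X : Finset V) : Finset V :=
  J.toFinset.filter fun w => J.head? ≠ some w ∧ J.getLast? ≠ some w ∧
    ∀ z, s(w, z) ∈ J.pathEdges → z ∈ X

lemma inner_mono (J : List V) {X Y : Finset V} (h : X ⊆ Y) : J.inner X ⊆ J.inner Y := by
  intro w hw
  simp only [inner, Finset.mem_filter] at hw ⊢
  exact ⟨hw.1, hw.2.1, hw.2.2.1, fun z hz => h (hw.2.2.2 z hz)⟩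

/-- The entries lost are the two ends and at most two neighbours along `J` for each vertex of `Z`.
-/
lemma length_le_card_inner {J : List V} (hJ : J.Nodup) (Z : Finset V) :
    J.length ≤ (J.inner Zᶜ).card + (2 + 2 * Z.card) := by
  set N : Finset V := Z.biUnion fun z => Finset.univ.filter fun w => s(z, w) ∈ J.pathEdges
  have hN : N.card ≤ Z.card * 2 :=
    Finset.card_biUnion_le_card_mul _ _ _ fun z _ => List.card_filter_mem_pathEdges_le_two hJ z
  have hsub : J.toFinset ⊆ J.inner Zᶜ ∪ (J.head?.toFinset ∪ J.getLast?.toFinset ∪ N) := by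
    intro w hw
    by_contra hcon
    simp only [Finset.mem_union, not_or, inner, Finset.mem_filter, hw, true_and,
      Option.mem_toFinset, Option.mem_def, N, Finset.mem_biUnion, Finset.mem_univ] at hcon
    refine hcon.1 ⟨hcon.2.1.1, hcon.2.1.2, fun z hz => ?_⟩
    rw [Finset.mem_compl]
    intro hzZ
    exact hcon.2.2 ⟨z, hzZ, by rwa [Sym2.eq_swap]⟩
  have h1 := Finset.card_le_card hsub
  rw [toFinset_card_of_nodup hJ] at h1
  have h2 := Finset.card_union_le (J.inner Zᶜ) (J.head?.toFinset ∪ J.getLast?.toFinset ∪ N)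
  have h3 := Finset.card_union_le (J.head?.toFinset ∪ J.getLast?.toFinset) N
  have h4 := Finset.card_union_le J.head?.toFinset J.getLast?.toFinset
  have h5 : J.head?.toFinset.card ≤ 1 := by cases J.head? <;> simp
  have h6 : J.getLast?.toFinset.card ≤ 1 := by cases J.getLast? <;> simp
  omega

/-- The `i`-th block of length `b` of `l`. -/
def block (l : List V) (b i : ℕ) : List V := (l.drop (i * b)).take b

lemma block_infix (l : List V) (b i : ℕ) : l.block b i <:+: l :=
  (take_prefix _ _).isInfix.trans (drop_suffix _ _).isInfix

lemma length_block {l : List V} {b i : ℕ} (h : (i + 1) * b ≤ l.length) :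
    (l.block b i).length = b := by
  rw [block, length_take, length_drop]
  rw [add_mul] at h
  omega

lemma block_disjoint {l : List V} (hl : l.Nodup) {b i j : ℕ} (hij : i < j) :
    (l.block b i).Disjoint (l.block b j) := by
  have h : (l.take (i * b + b)).Disjoint (l.drop (j * b)) := by
    refine disjoint_take_drop hl ?_
    calc i * b + b = (i + 1) * b := by ring
      _ ≤ j * b := Nat.mul_le_mul_right b hij
  intro x hx hx'
  refine h ?_ ((take_subset _ _) hx')
  rw [block, take_drop] at hx
  exact (drop_subset _ _) (by simpa [add_comm] using hx)

end List

namespace SimpleGraph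

variable {V : Type*} [DecidableEq V] [Fintype V]
variable {G : SimpleGraph V} [DecidableRel G.Adj] {d μ : ℝ}

/-- There is a set `X` of almost all vertices such that every vertex of `X` has many neighbours in
the interior of `J` whose two neighbours along `J` again lie in `X`. -/
lemma Mixing.exists_core (h : G.Mixing d μ) (hd : 0 < d) {J : List V}
    (hJ : J.Nodup) {z₀ : ℝ}
    (hz : 16 * μ ^ 2 * (Fintype.card V : ℝ) ^ 2 ≤ z₀ * d ^ 2 * J.length)
    (hz' : 4 * z₀ + 8 ≤ J.length) (hz0 : 0 ≤ z₀) :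
    ∃ X : Finset V, (Xᶜ.card : ℝ) ≤ z₀ ∧
      ∀ v ∈ X, d * J.length / (4 * Fintype.card V) ≤ ((J.inner X).filter (G.Adj v)).card := by
  classical
  set n : ℝ := (Fintype.card V : ℝ) with hn
  set b : ℝ := (J.length : ℝ) with hb
  set q := d * b / (4 * n) with hq
  have hbpos : 0 < b := by linarith
  have hnpos : 0 < n := by
    have : J ≠ [] := by
      rintro rfl
      simp [hb] at hbpos
    obtain ⟨v, _⟩ := List.exists_mem_of_ne_nil J this
    rw [hn]
    exact_mod_cast Fintype.card_pos_iff.2 ⟨v⟩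
  have hqpos : 0 < q := by positivity
  -- Take a largest `Z` with few edges to the inner part that it leaves. Mixing forces |Z| ≤ z₀, so
  -- the cap z₀ + 1 leaves room for one more vertex; a vertex outside `Z` with too few inner
  -- neighbours could then be added, against maximality.
  set F : Finset (Finset V) := Finset.univ.filter fun Z =>
    ((G.interedges Z (J.inner Zᶜ)).card : ℝ) ≤ q * Z.card ∧ (Z.card : ℝ) ≤ z₀ + 1
  have hF : F.Nonempty := by
    refine ⟨∅, ?_⟩
    rw [Finset.mem_filter, card_interedges_eq_sum]
    simp only [Finset.mem_univ, Finset.sum_empty, Finset.card_empty, Nat.cast_zero, mul_zero,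
      le_refl, true_and]
    linarith
  obtain ⟨Z, hZF, hZmax⟩ := F.exists_max_image Finset.card hF
  simp only [F, Finset.mem_filter, Finset.mem_univ, true_and] at hZF hZmax
  obtain ⟨hZe, hZc⟩ := hZF
  have hU : b / 2 ≤ (J.inner Zᶜ).card := by
    have : b ≤ (J.inner Zᶜ).card + (2 + 2 * Z.card) := by
      rw [hb]; exact_mod_cast List.length_le_card_inner hJ Z
    linarith
  have hZ : (Z.card : ℝ) ≤ z₀ := by
    set u : ℝ := ((J.inner Zᶜ).card : ℝ)
    set z : ℝ := (Z.card : ℝ)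
    have hz0' : 0 ≤ z := by positivity
    have hupos : 0 < u := by linarith
    have h1 := h.ge Z (J.inner Zᶜ)
    -- As the inner part has at least b/2 vertices, the main term is at least twice the permitted
    -- q|Z|, so the mixing error must cover half of it.
    have h2 : z * (d * u / (2 * n)) ≤ μ * √(z * u) := by
      have h3 : d * z * u / n = 2 * (z * (d * u / (2 * n))) := by field_simp
      have h4 : q * z ≤ z * (d * u / (2 * n)) := by
        rw [mul_comm]
        refine mul_le_mul_of_nonneg_left ?_ hz0'
        rw [hq, div_le_div_iff₀ (by positivity) (by positivity)]
        have : d * n * b ≤ d * n * (2 * u) := by gcongr; linarith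
        nlinarith
      change d * z * u / n - μ * √(z * u) ≤ _ at h1
      linarith
    rcases hz0'.eq_or_lt with hzero | hzpos
    · rw [← hzero]; exact hz0
    have h5 : (z * (d * u / (2 * n))) ^ 2 ≤ μ ^ 2 * (z * u) := by
      calc _ ≤ (μ * √(z * u)) ^ 2 := by gcongr
        _ = μ ^ 2 * (z * u) := by rw [mul_pow, Real.sq_sqrt (by positivity)]
    have h6 : z * u * d ^ 2 ≤ 4 * μ ^ 2 * n ^ 2 := by
      have e : (z * (d * u / (2 * n))) ^ 2 = (z * u) * (z * u * d ^ 2 / (4 * n ^ 2)) := by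
        field_simp
        ring
      rw [e, mul_comm (μ ^ 2)] at h5
      have := le_of_mul_le_mul_left h5 (by positivity)
      rw [div_le_iff₀ (by positivity)] at this
      linarith
    have h7 : z * (b / 2) * d ^ 2 ≤ z * u * d ^ 2 := by gcongr
    have h8 : z * (d ^ 2 * b) ≤ z₀ * (d ^ 2 * b) := by nlinarith
    exact le_of_mul_le_mul_right h8 (by positivity)
  refine ⟨Zᶜ, by simpa using hZ, ?_⟩
  intro v hv
  by_contra! hlt
  rw [Finset.mem_compl] at hv
  have hle := hZmax (insert v Z) ⟨?_, ?_⟩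
  · rw [Finset.card_insert_of_notMem hv] at hle
    omega
  · have hmono : J.inner (insert v Z)ᶜ ⊆ J.inner Zᶜ :=
      List.inner_mono J (Finset.compl_subset_compl.2 (Finset.subset_insert v Z))
    have hm : ∀ x, ((J.inner (insert v Z)ᶜ).filter (G.Adj x)).card ≤
        ((J.inner Zᶜ).filter (G.Adj x)).card :=
      fun x => Finset.card_le_card (Finset.filter_subset_filter _ hmono)
    rw [card_interedges_eq_sum, Finset.sum_insert hv, Finset.card_insert_of_notMem hv]
    rw [card_interedges_eq_sum] at hZe
    push_cast at hZe ⊢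
    have h1 : ∑ x ∈ Z, (((J.inner (insert v Z)ᶜ).filter (G.Adj x)).card : ℝ) ≤
        ∑ x ∈ Z, (((J.inner Zᶜ).filter (G.Adj x)).card : ℝ) :=
      Finset.sum_le_sum fun x _ => by exact_mod_cast hm x
    have h2 : (((J.inner (insert v Z)ᶜ).filter (G.Adj v)).card : ℝ) ≤
        (((J.inner Zᶜ).filter (G.Adj v)).card : ℝ) := by exact_mod_cast hm v
    linarith
  · rw [Finset.card_insert_of_notMem hv]
    push_cast
    linarith

/-- Without an edge, mixing would give d√(|S||T|) ≤ μn. -/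
lemma Mixing.exists_adj (h : G.Mixing d μ) (hd : 0 < d) {S T : Finset V} {s : ℝ}
    (hs : 0 < s) (hS : s ≤ S.card) (hT : s ≤ T.card) (hsd : μ * Fintype.card V < d * s) :
    ∃ x ∈ S, ∃ y ∈ T, G.Adj x y := by
  by_contra! hcon
  have h0 : G.interedges S T = ∅ := by
    rw [Finset.eq_empty_iff_forall_notMem]
    rintro ⟨x, y⟩ hxy
    rw [mem_interedges_iff] at hxy
    exact hcon x hxy.1 y hxy.2.1 hxy.2.2
  have h1 := h.ge S T
  rw [h0, Finset.card_empty, Nat.cast_zero] at h1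
  set a : ℝ := (S.card : ℝ)
  set c : ℝ := (T.card : ℝ)
  have hac : s ≤ √(a * c) := by
    refine Real.le_sqrt_of_sq_le ?_
    rw [sq]
    gcongr
  have hn : (0 : ℝ) < Fintype.card V := by
    have : S.Nonempty := by
      rw [← Finset.card_pos]
      have : (0 : ℝ) < (S.card : ℝ) := lt_of_lt_of_le hs hS
      exact_mod_cast this
    obtain ⟨v, -⟩ := this
    exact_mod_cast Fintype.card_pos_iff.2 ⟨v⟩
  have h2 : d * a * c = d * (√(a * c) * √(a * c)) := by
    rw [Real.mul_self_sqrt (by positivity)]; ring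
  have h3 : d * a * c ≤ μ * √(a * c) * Fintype.card V := by
    rw [← div_le_iff₀ hn]; linarith
  have h4 : 0 < √(a * c) := by linarith
  rw [h2] at h3
  have h5 : √(a * c) * (d * √(a * c)) ≤ √(a * c) * (μ * Fintype.card V) := by linarith
  have h6 := le_of_mul_le_mul_left h5 h4
  have h7 : d * s ≤ d * √(a * c) := by gcongr
  linarith

/-- If the ends of `A ++ B` are well connected to blocks in `A` and `B` respectively, then
rotating both ends independently makes the two ends adjacent. -/
lemma Mixing.exists_adj_ends_of_append (h : G.Mixing d μ) (hμ : 0 < μ) (hd : 0 < d) {q : ℝ}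
    (hq : 6 * μ ≤ q) (hqd : q ≤ d) (hq' : 14 * μ < q) {T : ℕ} (hT : Fintype.card V ≤ 2 ^ T)
    {A B J K : List V} (hAB : (A ++ B).Nodup) (hJ : J.Intact A) (hK : K.Intact B)
    {X Y : Finset V} (hX : ∀ v ∈ X, q ≤ ((J.inner X).filter (G.Adj v)).card)
    (hY : ∀ v ∈ Y, q ≤ ((K.inner Y).filter (G.Adj v)).card) {x y : V} (hx : A.head? = some x)
    (hxX : x ∈ X) (hy : B.getLast? = some y) (hyY : y ∈ Y) :
    ∃ l' : List V, l'.Perm (A ++ B) ∧ (l'.pathEdges \ (A ++ B).pathEdges).card ≤ 2 * T ∧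
      (∀ e ∈ l'.pathEdges, e ∈ (A ++ B).pathEdges ∨ e ∈ G.edgeSet) ∧
      ∃ u ∈ l'.head?, ∃ v ∈ l'.getLast?, G.Adj u v := by
  have hA : A.Nodup := hAB.of_append_left
  have hB : B.Nodup := hAB.of_append_right
  have hn : (0 : ℝ) < Fintype.card V := by exact_mod_cast Fintype.card_pos_iff.2 ⟨x⟩
  have hqpos : 0 < q := by linarith
  have hinner : ∀ {C L : List V} {Z : Finset V}, L.Nodup → C.Intact L → ∀ w ∈ C.inner Z,
      w ∈ L ∧ ∀ z, s(w, z) ∈ L.pathEdges → z ∈ Z := by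
    intro C L Z hL hC w hw
    simp only [List.inner, Finset.mem_filter, List.mem_toFinset] at hw
    exact ⟨hC.mem hw.1, fun z hz => hw.2.2.2 z (hC.mem_pathEdges hL hw.1 hw.2.1 hw.2.2.1 hz)⟩
  -- Rotations keep the first entry of a list. Rotating `A.reverse` therefore moves the outer end of
  -- `A` and preserves the junction pair with `B`.
  obtain ⟨S, -, hS, hSr⟩ := h.exists_endpoints hμ.le hd hq hqd hT (List.nodup_reverse.2 hA) hX
    (fun w hw => (hinner (List.nodup_reverse.2 hA) hJ.reverse w hw).1)
    (fun w hw => (hinner (List.nodup_reverse.2 hA) hJ.reverse w hw).2)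
    (by rw [List.getLast?_reverse]; exact hx) hxX
  obtain ⟨S', -, hS', hSr'⟩ := h.exists_endpoints hμ.le hd hq hqd hT hB hY
    (fun w hw => (hinner hB hK w hw).1) (fun w hw => (hinner hB hK w hw).2) hy hyY
  -- Both endpoint sets have at least qn/(14d) elements, and 14μ < q is what an edge between sets of
  -- this size requires.
  obtain ⟨u, hu, v, hv, huv⟩ := h.exists_adj (S := S) (T := S') (s := q * Fintype.card V / (14 * d)) hd
    (by positivity)
    (by rw [div_le_iff₀ (by positivity)]; linarith)
    (by rw [div_le_iff₀ (by positivity)]; linarith)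
    (by
      rw [show d * (q * Fintype.card V / (14 * d)) = q / 14 * Fintype.card V by field_simp]
      gcongr
      linarith)
  obtain ⟨A', hA', hAh, hAl⟩ := hSr u hu
  obtain ⟨B', hB', hBh, hBl⟩ := hSr' v hv
  have hmem : ∀ e ∈ (A'.reverse ++ B').pathEdges, e ∈ (A ++ B).pathEdges ∨
      e ∈ A'.pathEdges \ A.pathEdges ∨ e ∈ B'.pathEdges \ B.pathEdges := by
    intro e he
    rw [List.mem_pathEdges_append, List.pathEdges_reverse, List.getLast?_reverse, hAh,
      List.head?_reverse, hBh] at he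
    rw [List.mem_pathEdges_append, Finset.mem_sdiff, Finset.mem_sdiff]
    rcases he with he | he | he
    · by_cases heA : e ∈ A.pathEdges
      · exact Or.inl (Or.inl heA)
      · exact Or.inr (Or.inl ⟨he, heA⟩)
    · by_cases heB : e ∈ B.pathEdges
      · exact Or.inl (Or.inr (Or.inl heB))
      · exact Or.inr (Or.inr ⟨he, heB⟩)
    · exact Or.inl (Or.inr (Or.inr he))
  have hsA := hA'.card_sdiff
  rw [List.pathEdges_reverse] at hsA
  refine ⟨A'.reverse ++ B', ?_, ?_, ?_, u, ?_, v, ?_, huv⟩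
  · refine List.Perm.append ?_ hB'.perm
    exact (List.reverse_perm _).trans (hA'.perm.trans (List.reverse_perm _))
  · calc _ ≤ ((A'.pathEdges \ A.pathEdges) ∪ (B'.pathEdges \ B.pathEdges)).card := by
          apply Finset.card_le_card
          intro e he
          rw [Finset.mem_sdiff] at he
          rw [Finset.mem_union]
          exact (hmem e he.1).resolve_left he.2
      _ ≤ _ := Finset.card_union_le _ _
      _ ≤ T + T := add_le_add hsA hB'.card_sdiff
      _ = 2 * T := by ring
  · intro e he
    rcases hmem e he with he | he | he
    · exact Or.inl he
    · rw [Finset.mem_sdiff] at he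
      refine Or.inr ((hA'.adj e he.1).resolve_left ?_)
      rw [List.pathEdges_reverse]; exact he.2
    · rw [Finset.mem_sdiff] at he
      exact Or.inr ((hB'.adj e he.1).resolve_left he.2)
  · rw [List.head?_append, List.head?_reverse, hAl]; rfl
  · rw [List.getLast?_append, hBl]; rfl

/-- Of more than `|D| + 1` disjoint blocks, two avoid a given set `D` of pairs. -/
lemma exists_blocks_disjoint {l : List V} (hl : l.Nodup) {b M : ℕ} {D : Finset (Sym2 V)}
    (hD : D.card + 2 ≤ M) :
    ∃ i < M, ∃ j < M, i < j ∧ Disjoint D (l.block b i).pathEdges ∧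
      Disjoint D (l.block b j).pathEdges := by
  classical
  set good := (Finset.range M).filter fun i => Disjoint D (l.block b i).pathEdges
  set bad := (Finset.range M).filter fun i => ¬ Disjoint D (l.block b i).pathEdges
  have hadd : good.card + bad.card = M := by
    rw [Finset.card_filter_add_card_filter_not, Finset.card_range]
  have hbad : bad.card ≤ D.card := by
    have hex : ∀ i ∈ bad, ∃ e ∈ D, e ∈ (l.block b i).pathEdges := by
      intro i hi
      simp only [bad, Finset.mem_filter] at hi
      exact Finset.not_disjoint_iff.1 hi.2
    rcases bad.eq_empty_or_nonempty with h0 | ⟨i₀, hi₀⟩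
    · simp [h0]
    have : Nonempty (Sym2 V) := ⟨(hex i₀ hi₀).choose⟩
    choose! f hf hf' using hex
    -- Blocks are disjoint, so a pair of `D` can occur in only one of them.
    refine Finset.card_le_card_of_injOn f hf ?_
    intro i hi j hj hij
    have hx : ∃ x, x ∈ f i := ⟨_, Sym2.out_fst_mem (f i)⟩
    obtain ⟨x, hx⟩ := hx
    have hxi := List.mem_of_mem_pathEdges (hf' i hi) hx
    have hxj := List.mem_of_mem_pathEdges (hf' j hj) (hij ▸ hx)
    rcases lt_trichotomy i j with hlt | heq | hlt
    · exact absurd hxj (List.block_disjoint hl hlt hxi)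
    · exact heq
    · exact absurd hxi (List.block_disjoint hl hlt hxj)
  obtain ⟨i, hi, j, hj, hij⟩ := Finset.one_lt_card.1 (show 1 < good.card by omega)
  simp only [good, Finset.mem_filter, Finset.mem_range] at hi hj
  rcases lt_or_gt_of_ne hij with hlt | hlt
  · exact ⟨i, hi.1, j, hj.1, hlt, hi.2, hj.2⟩
  · exact ⟨j, hj.1, i, hi.1, hlt, hj.2, hi.2⟩

/-- A union bound, used to pick an endpoint that lies in all cores at once. -/
lemma exists_mem_forall_mem {M : ℕ} {S : Finset V} {X : ℕ → Finset V} {z : ℝ}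
    (hX : ∀ i < M, ((X i)ᶜ.card : ℝ) ≤ z) (hS : M * z < S.card) :
    ∃ v ∈ S, ∀ i < M, v ∈ X i := by
  by_contra! hcon
  have hsub : S ⊆ (Finset.range M).biUnion fun i => (X i)ᶜ := by
    intro v hv
    obtain ⟨i, hi, hvi⟩ := hcon v hv
    simp only [Finset.mem_biUnion, Finset.mem_range, Finset.mem_compl]
    exact ⟨i, hi, hvi⟩
  have h1 : (S.card : ℝ) ≤ ∑ i ∈ Finset.range M, ((X i)ᶜ.card : ℝ) := by
    exact_mod_cast (Finset.card_le_card hsub).trans Finset.card_biUnion_le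
  have h2 : ∑ i ∈ Finset.range M, ((X i)ᶜ.card : ℝ) ≤ ∑ i ∈ Finset.range M, z :=
    Finset.sum_le_sum fun i hi => hX i (Finset.mem_range.1 hi)
  simp only [Finset.sum_const, Finset.card_range, nsmul_eq_mul] at h2
  linarith

/-- Any ordering of the vertices can be changed in few places, using edges of `G` only, so that
its ends become adjacent. -/
lemma Mixing.exists_adj_ends (h : G.Mixing d μ) (hμ : 0 < μ) (hd : 0 < d) {T b : ℕ}
    (hT : Fintype.card V ≤ 2 ^ T) (hb : 9 ≤ b) (hbn : (2 * T + 2) * b ≤ Fintype.card V)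
    (hdb : 57 * (2 * T + 2) * μ * Fintype.card V ≤ d * b)
    (hdeg : ∀ v, d / 4 ≤ G.degree v) {l : List V} (hl : l.Nodup) (hmem : ∀ v, v ∈ l) :
    ∃ l' : List V, l'.Perm l ∧ (l'.pathEdges \ l.pathEdges).card ≤ 4 * T ∧
      (∀ e ∈ l'.pathEdges, e ∈ l.pathEdges ∨ e ∈ G.edgeSet) ∧
      ∃ u ∈ l'.head?, ∃ v ∈ l'.getLast?, G.Adj u v := by
  set M := 2 * T + 2 with hM
  have hMr : (2 * (T : ℝ) + 2) = M := by rw [hM]; push_cast; ring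
  rw [hMr] at hdb
  have hM2 : (2 : ℝ) ≤ M := by exact_mod_cast (by omega : 2 ≤ M)
  set n : ℝ := (Fintype.card V : ℝ) with hn
  have hb9 : (9 : ℝ) ≤ b := by exact_mod_cast hb
  have hlen : l.length = Fintype.card V := by
    rw [← List.toFinset_card_of_nodup hl, ← Finset.card_univ]
    congr 1
    ext v
    simp [hmem v]
  have hbnr : M * (b : ℝ) ≤ n := by rw [hn]; exact_mod_cast hbn
  have hnpos : 0 < n := by nlinarith
  have hblen : ∀ i < M, (l.block b i).length = b := fun i hi =>
    List.length_block (by rw [hlen]; exact (Nat.mul_le_mul_right b hi).trans hbn)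
  -- The inner degree that `Mixing.exists_core` provides for a block of length `b`.
  set q := d * b / (4 * n) with hq
  have hq14 : 14 * μ < q := by
    rw [hq, lt_div_iff₀ (by positivity)]
    have h1 : 0 < μ * n := by positivity
    nlinarith
  have hqd : q ≤ d / 4 := by
    rw [hq, div_le_div_iff₀ (by positivity) (by positivity)]
    have : (b : ℝ) ≤ n := by nlinarith
    nlinarith
  -- The `M` cores together exclude at most M z₀ = b/57 vertices, fewer than the b/56 endpoints that
  -- rotation guarantees.
  set z₀ : ℝ := (b : ℝ) / (57 * M) with hz₀
  have hcore : ∀ i < M, ∃ X : Finset V, (Xᶜ.card : ℝ) ≤ z₀ ∧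
      ∀ v ∈ X, q ≤ (((l.block b i).inner X).filter (G.Adj v)).card := by
    intro i hi
    have := h.exists_core hd (J := l.block b i) (z₀ := z₀)
      ((List.block_infix l b i).sublist.nodup hl) ?_ ?_ (by positivity)
    · rwa [hblen i hi] at this
    · rw [hblen i hi]
      have e : z₀ * d ^ 2 * b = (d * b) ^ 2 / (57 * M) := by rw [hz₀]; field_simp
      rw [e, le_div_iff₀ (by positivity)]
      have h1 : (57 * M * μ * n) ^ 2 ≤ (d * b) ^ 2 := by gcongr
      have h2 : 0 ≤ μ ^ 2 * n ^ 2 * M := by positivity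
      nlinarith
    · rw [hblen i hi]
      have : z₀ ≤ b / 114 := by
        rw [hz₀]
        gcongr
        linarith
      linarith
  choose! X hXc hX using hcore
  have hpick : ∀ S : Finset V, q * n ≤ 14 * d * S.card → ∃ v ∈ S, ∀ i < M, v ∈ X i := by
    intro S hS
    refine exists_mem_forall_mem hXc ?_
    have e : q * n = d * (b / 4) := by rw [hq]; field_simp
    rw [e] at hS
    have h1 : (b : ℝ) / 4 ≤ 14 * S.card := by
      refine le_of_mul_le_mul_left ?_ hd
      linarith
    have h2 : M * z₀ = b / 57 := by rw [hz₀]; field_simp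
    linarith
  have hdegq : ∀ v ∈ (Finset.univ : Finset V), q ≤ (Finset.univ.filter (G.Adj v)).card := by
    intro v _
    refine hqd.trans ((hdeg v).trans_eq ?_)
    rw [← G.card_neighborFinset_eq_degree, G.neighborFinset_eq_filter]
  have hne : l ≠ [] := by
    rintro rfl
    rw [hn, ← hlen] at hnpos
    simp at hnpos
  -- Both ends are first rotated along the whole ordering, with every vertex allowed as pivot and
  -- endpoint, until each lies in all cores.
  obtain ⟨S, -, hS, hSr⟩ := h.exists_endpoints hμ.le hd (by linarith) (by linarith) hT hl hdegq
    (fun w _ => hmem w) (fun _ _ _ _ => Finset.mem_univ _)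
    (List.getLast?_eq_getLast_of_ne_nil hne) (Finset.mem_univ _)
  obtain ⟨a, haS, haX⟩ := hpick S hS
  obtain ⟨l₁, hl₁, -, hl₁a⟩ := hSr a haS
  have hl₁r : l₁.reverse.Nodup := List.nodup_reverse.2 (hl₁.perm.nodup_iff.2 hl)
  have hne₁ : l₁.reverse ≠ [] := by
    rw [Ne, List.reverse_eq_nil_iff]
    rintro rfl
    simp at hl₁a
  obtain ⟨S', -, hS', hSr'⟩ := h.exists_endpoints hμ.le hd (by linarith) (by linarith) hT hl₁r
    hdegq (fun w _ => List.mem_reverse.2 (hl₁.perm.mem_iff.2 (hmem w)))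
    (fun _ _ _ _ => Finset.mem_univ _) (List.getLast?_eq_getLast_of_ne_nil hne₁)
    (Finset.mem_univ _)
  obtain ⟨c, hcS, hcX⟩ := hpick S' hS'
  obtain ⟨l₂, hl₂, hl₂a, hl₂c⟩ := hSr' c hcS
  have hre : G.Rerouted (T + T) l l₂.reverse := by
    refine hl₁.trans ?_
    simpa using hl₂.reverse
  set l₃ := l₂.reverse with hl₃
  have hl₃n : l₃.Nodup := hre.perm.nodup_iff.2 hl
  have hl₃h : l₃.head? = some c := by rw [hl₃, List.head?_reverse]; exact hl₂c
  have hl₃l : l₃.getLast? = some a := by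
    rw [hl₃, List.getLast?_reverse, hl₂a, List.head?_reverse]; exact hl₁a
  -- At most 2T pairs have been broken, so two of the 2T + 2 blocks are intact.
  obtain ⟨D, hD, hDint⟩ := hre.intact
  obtain ⟨i, hi, j, hj, hij, hDi, hDj⟩ := exists_blocks_disjoint (b := b) (M := M) hl
    (D := D) (by omega)
  have hIi := hDint _ (Or.inl (List.block_infix l b i)) hDi
  have hIj := hDint _ (Or.inl (List.block_infix l b j)) hDj
  have hne0 : ∀ {k}, k < M → l.block b k ≠ [] := by
    intro k hk h0
    have := hblen k hk
    rw [h0] at this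
    simp at this
    omega
  have hfin : ∃ l' : List V, l'.Perm l₃ ∧ (l'.pathEdges \ l₃.pathEdges).card ≤ 2 * T ∧
      (∀ e ∈ l'.pathEdges, e ∈ l₃.pathEdges ∨ e ∈ G.edgeSet) ∧
      ∃ u ∈ l'.head?, ∃ v ∈ l'.getLast?, G.Adj u v := by
    obtain ⟨A, B, hAB, hcase⟩ := hIi.exists_append hIj (hne0 hi) (List.block_disjoint hl hij)
    -- Rotations may have exchanged the order of the two blocks, so `main` does not assume i < j.
    have main : ∀ i < M, ∀ j < M, (l.block b i).Intact A → (l.block b j).Intact B →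
        ∃ l' : List V, l'.Perm l₃ ∧ (l'.pathEdges \ l₃.pathEdges).card ≤ 2 * T ∧
        (∀ e ∈ l'.pathEdges, e ∈ l₃.pathEdges ∨ e ∈ G.edgeSet) ∧
        ∃ u ∈ l'.head?, ∃ v ∈ l'.getLast?, G.Adj u v := by
      intro i hi j hj hiA hjB
      obtain ⟨x, hx⟩ := List.exists_mem_of_ne_nil _ (hne0 hi)
      obtain ⟨y, hy⟩ := List.exists_mem_of_ne_nil _ (hne0 hj)
      have hA0 : A ≠ [] := List.ne_nil_of_mem (hiA.mem hx)
      have hB0 : B ≠ [] := List.ne_nil_of_mem (hjB.mem hy)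
      rw [hAB] at hl₃n hl₃h hl₃l ⊢
      rw [List.head?_append_of_ne_nil _ hA0] at hl₃h
      rw [List.getLast?_append_of_ne_nil _ hB0] at hl₃l
      exact h.exists_adj_ends_of_append hμ hd (by linarith) (by linarith) hq14 hT hl₃n hiA hjB
        (hX i hi) (hX j hj) hl₃h (hcX i hi) hl₃l (haX j hj)
    rcases hcase with ⟨h1, h2⟩ | ⟨h1, h2⟩
    · exact main i hi j hj h1 h2
    · exact main j hj i hi h1 h2
  obtain ⟨l', hp, hc, hadj, hends⟩ := hfin
  refine ⟨l', hp.trans hre.perm, ?_, ?_, hends⟩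
  · have h1 := card_sdiff_le_add l'.pathEdges l₃.pathEdges l.pathEdges
    have h2 := hre.card_sdiff
    omega
  · intro e he
    rcases hadj e he with he | he
    · exact hre.adj e he
    · exact Or.inr he

end SimpleGraph

/-! ### From orderings with few non-edges to Hamilton cycles -/

/-- A set of at most `k` elements is the set of `some` values of a map `Fin k → Option α`. -/
lemma Finset.card_filter_card_le (α : Type*) [DecidableEq α] [Fintype α] (k : ℕ) :
    (Finset.univ.filter fun s : Finset α => s.card ≤ k).card ≤ (Fintype.card α + 1) ^ k := by
  classical
  have hsub : (Finset.univ.filter fun s : Finset α => s.card ≤ k) ⊆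
      Finset.univ.image fun f : Fin k → Option α => Finset.univ.filter fun a => ∃ i, f i = some a := by
    intro s hs
    simp only [Finset.mem_filter, Finset.mem_univ, true_and] at hs
    refine Finset.mem_image.2 ⟨fun i => s.toList[(i : ℕ)]?, Finset.mem_univ _, ?_⟩
    ext a
    simp only [Finset.mem_filter, Finset.mem_univ, true_and]
    rw [← Finset.mem_toList, List.mem_iff_getElem?]
    constructor
    · rintro ⟨i, hi⟩
      exact ⟨i, hi⟩
    · rintro ⟨i, hi⟩
      refine ⟨⟨i, lt_of_lt_of_le ?_ hs⟩, hi⟩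
      rw [← Finset.length_toList]
      exact (List.getElem?_eq_some_iff.1 hi).1
  refine (Finset.card_le_card hsub).trans (Finset.card_image_le.trans ?_)
  simp

namespace List

variable {V : Type*} [DecidableEq V]

lemma exists_append_of_mem_pathEdges {l : List V} {e : Sym2 V} (he : e ∈ l.pathEdges) :
    ∃ A B : List V, l = A ++ B ∧ ∃ x ∈ A.getLast?, ∃ y ∈ B.head?, e = s(x, y) := by
  induction l with
  | nil => simp at he
  | cons a l ih =>
    rcases mem_pathEdges_cons.1 he with he | ⟨y, hy, rfl⟩
    · obtain ⟨A, B, rfl, x, hx, y, hy, rfl⟩ := ih he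
      refine ⟨a :: A, B, rfl, x, ?_, y, hy, rfl⟩
      cases A with
      | nil => simp at hx
      | cons b A => rwa [getLast?_cons_cons]
    · exact ⟨[a], l, rfl, a, by simp, y, hy, rfl⟩

lemma isChain_adj_iff {G : SimpleGraph V} {l : List V} :
    l.IsChain G.Adj ↔ ∀ e ∈ l.pathEdges, e ∈ G.edgeSet := by
  induction l with
  | nil => simp
  | cons a l ih =>
    rw [isChain_cons, ih]
    simp only [mem_pathEdges_cons]
    constructor
    · rintro ⟨h1, h2⟩ e (he | ⟨y, hy, rfl⟩)
      · exact h2 e he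
      · exact h1 y hy
    · intro h
      exact ⟨fun y hy => h _ (Or.inr ⟨y, hy, rfl⟩), fun e he => h e (Or.inl he)⟩

end List

namespace SimpleGraph

variable {V : Type*} [DecidableEq V] [Fintype V]

variable (V) in
/-- All orderings of the vertex set. -/
noncomputable def orderings : Finset (List V) := (Finset.univ : Finset V).toList.permutations.toFinset

lemma mem_orderings {l : List V} : l ∈ orderings V ↔ l.Nodup ∧ ∀ v, v ∈ l := by
  rw [orderings, List.mem_toFinset, List.mem_permutations]
  constructor
  · intro h
    exact ⟨h.nodup_iff.2 (Finset.nodup_toList _), fun v => h.mem_iff.2 (by simp)⟩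
  · rintro ⟨h1, h2⟩
    rw [List.perm_ext_iff_of_nodup h1 (Finset.nodup_toList _)]
    simp [h2]

lemma length_of_mem_orderings {l : List V} (h : l ∈ orderings V) : l.length = Fintype.card V := by
  rw [mem_orderings] at h
  rw [← List.toFinset_card_of_nodup h.1, ← Finset.card_univ]
  congr 1
  ext v
  simp [h.2 v]

variable (G : SimpleGraph V) [DecidableRel G.Adj]

/-- The orderings of the vertices that run along a Hamilton cycle. -/
noncomputable def cyclicOrderings : Finset (List V) :=
  (orderings V).filter fun l => (∀ e ∈ l.pathEdges, e ∈ G.edgeSet) ∧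
    ∃ u ∈ l.head?, ∃ v ∈ l.getLast?, G.Adj u v

/-- The consecutive pairs of `l` that are not edges. -/
def badEdges (l : List V) : Finset (Sym2 V) := l.pathEdges.filter (· ∉ G.edgeSet)

variable {G}

/-- If every ordering can be closed up by `c` changes, then an ordering with at most `m` non-edges
differs from a Hamilton cycle in few places. -/
lemma exists_cyclicOrdering {c : ℕ} (hc : ∀ l ∈ orderings V, ∃ l' : List V, l'.Perm l ∧
      (l'.pathEdges \ l.pathEdges).card ≤ c ∧
      (∀ e ∈ l'.pathEdges, e ∈ l.pathEdges ∨ e ∈ G.edgeSet) ∧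
      ∃ u ∈ l'.head?, ∃ v ∈ l'.getLast?, G.Adj u v) (m : ℕ) :
    ∀ l ∈ orderings V, (G.badEdges l).card ≤ m → ∃ h ∈ G.cyclicOrderings,
      (h.pathEdges \ l.pathEdges).card ≤ (m + 1) * (c + 1) := by
  induction m with
  | zero =>
    intro l hl hm
    obtain ⟨l', hp, hcard, hadj, hends⟩ := hc l hl
    refine ⟨l', ?_, by omega⟩
    have hl' : l' ∈ orderings V := by
      rw [mem_orderings] at hl ⊢
      exact ⟨hp.nodup_iff.2 hl.1, fun v => hp.mem_iff.2 (hl.2 v)⟩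
    refine Finset.mem_filter.2 ⟨hl', fun e he => ?_, hends⟩
    by_contra hcon
    have h1 := (hadj e he).resolve_right hcon
    have h2 : e ∈ G.badEdges l := Finset.mem_filter.2 ⟨h1, hcon⟩
    rw [Nat.le_zero, Finset.card_eq_zero] at hm
    rw [hm] at h2
    simp at h2
  | succ m ih =>
    intro l hl hm
    obtain ⟨l', hp, hcard, hadj, hends⟩ := hc l hl
    have hl' : l' ∈ orderings V := by
      rw [mem_orderings] at hl ⊢
      exact ⟨hp.nodup_iff.2 hl.1, fun v => hp.mem_iff.2 (hl.2 v)⟩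
    have hbad : G.badEdges l' ⊆ G.badEdges l := by
      intro e he
      rw [badEdges, Finset.mem_filter] at he ⊢
      exact ⟨(hadj e he.1).resolve_right he.2, he.2⟩
    by_cases hgood : ∀ e ∈ l'.pathEdges, e ∈ G.edgeSet
    · exact ⟨l', Finset.mem_filter.2 ⟨hl', hgood, hends⟩, by nlinarith⟩
    push Not at hgood
    obtain ⟨e, he, heG⟩ := hgood
    -- Close up along the edge uv and cut at the non-edge xy: passing from `A ++ B` to `B ++ A`
    -- gains only the pair uv and loses xy.
    obtain ⟨A, B, rfl, x, hx, y, hy, rfl⟩ := List.exists_append_of_mem_pathEdges he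
    have hnd := (mem_orderings.1 hl').1
    have hxA := List.mem_of_mem_getLast? hx
    have hyB := List.mem_of_mem_head? hy
    have hdis : A.Disjoint B := List.disjoint_of_nodup_append hnd
    obtain ⟨u, hu, v, hv, huv⟩ := hends
    have hA0 : A ≠ [] := List.ne_nil_of_mem hxA
    have hB0 : B ≠ [] := List.ne_nil_of_mem hyB
    rw [List.head?_append_of_ne_nil _ hA0] at hu
    rw [List.getLast?_append_of_ne_nil _ hB0] at hv
    have hBA : ∀ f ∈ (B ++ A).pathEdges, f = s(u, v) ∨
        f ∈ (A ++ B).pathEdges ∧ f ≠ s(x, y) := by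
      intro f hf
      rw [List.mem_pathEdges_append] at hf
      rcases hf with hf | hf | ⟨a, ha, b, hb, rfl⟩
      · refine Or.inr ⟨List.mem_pathEdges_append.2 (Or.inr (Or.inl hf)), ?_⟩
        rintro rfl
        exact hdis hxA (List.mem_of_mem_pathEdges hf (Sym2.mem_mk_left _ _))
      · refine Or.inr ⟨List.mem_pathEdges_append.2 (Or.inl hf), ?_⟩
        rintro rfl
        exact hdis (List.mem_of_mem_pathEdges hf (Sym2.mem_mk_right _ _)) hyB
      · left
        rw [Option.mem_unique ha hv, Option.mem_unique hb hu, Sym2.eq_swap]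
    have hlt : (G.badEdges (B ++ A)).card < (G.badEdges (A ++ B)).card := by
      apply Finset.card_lt_card
      rw [Finset.ssubset_iff_of_subset]
      · refine ⟨s(x, y), Finset.mem_filter.2 ⟨he, heG⟩, fun hcon => ?_⟩
        rcases hBA _ (Finset.mem_filter.1 hcon).1 with h | h
        · rw [h] at heG
          exact heG huv
        · exact h.2 rfl
      · intro f hf
        rw [badEdges, Finset.mem_filter] at hf ⊢
        refine ⟨?_, hf.2⟩
        rcases hBA f hf.1 with rfl | h
        · exact absurd huv hf.2
        · exact h.1
    have hBAo : B ++ A ∈ orderings V := by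
      rw [mem_orderings] at hl' ⊢
      exact ⟨List.perm_append_comm.nodup_iff.1 hl'.1, fun v =>
        List.perm_append_comm.mem_iff.1 (hl'.2 v)⟩
    obtain ⟨h, hh, hhc⟩ := ih (B ++ A) hBAo (by
      have := Finset.card_le_card hbad
      omega)
    refine ⟨h, hh, ?_⟩
    have h1 := card_sdiff_le_add h.pathEdges (B ++ A).pathEdges l.pathEdges
    have h2 := card_sdiff_le_add (B ++ A).pathEdges (A ++ B).pathEdges l.pathEdges
    have h3 : ((B ++ A).pathEdges \ (A ++ B).pathEdges).card ≤ 1 := by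
      rw [← Finset.card_singleton s(u, v)]
      apply Finset.card_le_card
      intro f hf
      rw [Finset.mem_sdiff] at hf
      rcases hBA f hf.1 with h | h
      · simpa using h
      · exact absurd h.1 hf.2
    calc _ ≤ (m + 1) * (c + 1) + (c + 1) := by omega
      _ = _ := by ring

/-- Few orderings are close to a given set of orderings. -/
lemma card_le_of_close {P Q : Finset (List V)} (hP : P ⊆ orderings V) (hQ : Q ⊆ orderings V)
    {k : ℕ} (h : ∀ l ∈ P, ∃ h ∈ Q, (h.pathEdges \ l.pathEdges).card ≤ k) :
    P.card ≤ Q.card * ((Fintype.card V + 1) * ((Fintype.card V ^ 2 + 1) ^ k) ^ 2) := by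
  classical
  choose! f hf hfk using h
  set R := Finset.univ.filter fun s : Finset (Sym2 V) => s.card ≤ k with hR
  have hRc : R.card ≤ (Fintype.card V ^ 2 + 1) ^ k := by
    refine (Finset.card_filter_card_le _ k).trans ?_
    gcongr
    rw [sq, ← Fintype.card_prod]
    exact Fintype.card_le_of_surjective (fun p : V × V => s(p.1, p.2)) fun e => by
      induction e with | h x y => exact ⟨(x, y), rfl⟩
  have hcard : ∀ l ∈ orderings V, l.pathEdges.card = Fintype.card V - 1 := fun l hl => by
    rw [List.card_pathEdges (mem_orderings.1 hl).1, length_of_mem_orderings hl]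
  -- An ordering is encoded by a close member of `Q`, its first vertex and the two differences of
  -- pair sets. Both orderings have n - 1 pairs, so the differences have equal size.
  calc P.card ≤ (Q ×ˢ (Finset.univ : Finset (Option V)) ×ˢ (R ×ˢ R)).card := by
        refine Finset.card_le_card_of_injOn (fun l => (f l, l.head?,
          ((f l).pathEdges \ l.pathEdges, l.pathEdges \ (f l).pathEdges))) ?_ ?_
        · intro l hl
          simp only [Finset.coe_product, Set.mem_prod, Finset.mem_coe, Finset.mem_univ, true_and,
            hR, Finset.mem_filter]
          refine ⟨hf l hl, hfk l hl, ?_⟩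
          refine le_trans (le_of_eq ?_) (hfk l hl)
          exact Finset.card_sdiff_comm ((hcard l (hP hl)).trans (hcard _ (hQ (hf l hl))).symm)
        · intro l hl l' hl' heq
          simp only [Prod.mk.injEq] at heq
          obtain ⟨h1, h2, h3, h4⟩ := heq
          refine List.eq_of_head_eq_of_pathEdges_eq (mem_orderings.1 (hP hl)).1
            (mem_orderings.1 (hP hl')).1 h2 ?_
          rw [← h1] at h3 h4
          ext e
          have h3e := congrArg (e ∈ ·) h3
          have h4e := congrArg (e ∈ ·) h4
          simp only [Finset.mem_sdiff, eq_iff_iff] at h3e h4e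
          tauto
    _ = Q.card * ((Fintype.card V + 1) * (R.card * R.card)) := by
        simp [Finset.card_product]
    _ ≤ _ := by rw [← sq]; gcongr

end SimpleGraph

/-! ### Path families and the double counting of merges and cuts -/

namespace SimpleGraph

variable {V : Type*} [DecidableEq V] [Fintype V]

/-- A set of disjoint nonempty paths of `G`, given as vertex lists, that cover all vertices. -/
structure IsPathFamily (G : SimpleGraph V) (L : Finset (List V)) : Prop where
  ne_nil : ∀ p ∈ L, p ≠ []
  nodup : ∀ p ∈ L, p.Nodup
  chain : ∀ p ∈ L, p.IsChain G.Adj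
  cover : ∀ v, ∃ p ∈ L, v ∈ p
  eq_of_mem : ∀ p ∈ L, ∀ q ∈ L, ∀ v, v ∈ p → v ∈ q → p = q

open scoped Classical in
/-- The families of `j` disjoint paths covering all vertices. -/
noncomputable def pathFamilies (G : SimpleGraph V) (j : ℕ) : Finset (Finset (List V)) :=
  (((Finset.univ : Finset {l : List V // l.Nodup}).map (Function.Embedding.subtype _)).powerset).filter
    fun L => G.IsPathFamily L ∧ L.card = j

variable {G : SimpleGraph V} {L : Finset (List V)} {j : ℕ}

lemma mem_pathFamilies : L ∈ G.pathFamilies j ↔ G.IsPathFamily L ∧ L.card = j := by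
  classical
  rw [pathFamilies, Finset.mem_filter, and_iff_right_iff_imp]
  rintro ⟨h, -⟩
  rw [Finset.mem_powerset]
  intro p hp
  simpa using h.nodup p hp

/-- The set of first vertices of the paths in `L`. -/
def heads (L : Finset (List V)) : Finset V :=
  Finset.univ.filter fun v => ∃ p ∈ L, p.head? = some v

/-- The set of last vertices of the paths in `L`. -/
def lasts (L : Finset (List V)) : Finset V :=
  Finset.univ.filter fun v => ∃ p ∈ L, p.getLast? = some v

lemma IsPathFamily.card_heads (h : G.IsPathFamily L) : (heads L).card = L.card := by
  symm
  refine Finset.card_bij (fun p hp => p.head (h.ne_nil p hp)) ?_ ?_ ?_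
  · intro p hp
    exact Finset.mem_filter.2 ⟨Finset.mem_univ _, p, hp, List.head?_eq_some_head _⟩
  · intro p hp q hq hpq
    exact h.eq_of_mem p hp q hq _ (List.head_mem (h.ne_nil p hp))
      (hpq ▸ List.head_mem (h.ne_nil q hq))
  · intro v hv
    obtain ⟨p, hp, hpv⟩ := (Finset.mem_filter.1 hv).2
    refine ⟨p, hp, ?_⟩
    rw [List.head?_eq_some_head (h.ne_nil p hp)] at hpv
    simpa using hpv

lemma IsPathFamily.card_lasts (h : G.IsPathFamily L) : (lasts L).card = L.card := by
  symm
  refine Finset.card_bij (fun p hp => p.getLast (h.ne_nil p hp)) ?_ ?_ ?_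
  · intro p hp
    exact Finset.mem_filter.2 ⟨Finset.mem_univ _, p, hp, List.getLast?_eq_getLast_of_ne_nil _⟩
  · intro p hp q hq hpq
    exact h.eq_of_mem p hp q hq _ (List.getLast_mem (h.ne_nil p hp))
      (hpq ▸ List.getLast_mem (h.ne_nil q hq))
  · intro v hv
    obtain ⟨p, hp, hpv⟩ := (Finset.mem_filter.1 hv).2
    refine ⟨p, hp, ?_⟩
    rw [List.getLast?_eq_getLast_of_ne_nil (h.ne_nil p hp)] at hpv
    simpa using hpv

/-- The ordered pairs of distinct paths that can be concatenated along an edge. -/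
def merges (G : SimpleGraph V) [DecidableRel G.Adj] (L : Finset (List V)) :
    Finset (List V × List V) :=
  (L ×ˢ L).filter fun x => x.1 ≠ x.2 ∧ ∃ u v, x.1.getLast? = some u ∧ x.2.head? = some v ∧ G.Adj u v

/-- The ways to cut a path of the family into two. -/
def splits (L : Finset (List V)) : Finset (List V × List V) :=
  L.biUnion fun r => ((Finset.range (r.length - 1)).image fun i => (r.take (i + 1), r.drop (i + 1)))

lemma mem_splits {x : List V × List V} :
    x ∈ splits L ↔ x.1 ≠ [] ∧ x.2 ≠ [] ∧ x.1 ++ x.2 ∈ L := by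
  simp only [splits, Finset.mem_biUnion, Finset.mem_image, Finset.mem_range]
  constructor
  · rintro ⟨r, hr, i, hi, rfl⟩
    have : r ≠ [] := by rintro rfl; simp at hi
    refine ⟨?_, ?_, by simpa⟩
    · simpa using this
    · rw [Ne, List.drop_eq_nil_iff]; omega
  · rintro ⟨h1, h2, h3⟩
    have h1' := List.length_pos_iff.2 h1
    have h2' := List.length_pos_iff.2 h2
    refine ⟨_, h3, x.1.length - 1, by simp; omega, ?_⟩
    rw [Nat.sub_add_cancel h1']
    simp

/-- A cut is determined by the first vertex of its right part, which can be any vertex that does not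
start a path. -/
lemma IsPathFamily.card_splits (h : G.IsPathFamily L) :
    (splits L).card = Fintype.card V - L.card := by
  rw [← h.card_heads, ← Finset.card_univ, ← Finset.card_sdiff_of_subset (Finset.subset_univ _)]
  refine Finset.card_bij (fun x hx => x.2.head (mem_splits.1 hx).2.1) ?_ ?_ ?_
  · rintro ⟨p, q⟩ hx
    obtain ⟨hp, hq, hpq⟩ := mem_splits.1 hx
    rw [Finset.mem_sdiff]
    refine ⟨Finset.mem_univ _, fun hcon => ?_⟩
    obtain ⟨r, hr, hrv⟩ := (Finset.mem_filter.1 hcon).2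
    have hmem : q.head hq ∈ q := List.head_mem hq
    have := h.eq_of_mem r hr _ hpq (q.head hq) (List.mem_of_mem_head? hrv)
      (List.mem_append_right _ hmem)
    subst this
    rw [List.head?_append_of_ne_nil _ hp] at hrv
    exact List.disjoint_of_nodup_append (h.nodup _ hpq) (List.mem_of_mem_head? hrv) hmem
  · rintro ⟨p, q⟩ hx ⟨p', q'⟩ hx' heq
    obtain ⟨hp, hq, hpq⟩ := mem_splits.1 hx
    obtain ⟨hp', hq', hpq'⟩ := mem_splits.1 hx'
    simp only at heq hp hq hpq hp' hq' hpq'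
    have e := h.eq_of_mem _ hpq _ hpq' (q.head hq) (List.mem_append_right _ (List.head_mem hq))
      (List.mem_append_right _ (heq ▸ List.head_mem hq'))
    obtain ⟨a, q, rfl⟩ := List.exists_cons_of_ne_nil hq
    obtain ⟨a', q', rfl⟩ := List.exists_cons_of_ne_nil hq'
    simp only [List.head_cons] at heq
    subst heq
    have hnd := h.nodup _ hpq
    have hnd' := h.nodup _ hpq'
    have h1 : a ∉ p := fun ha => List.disjoint_of_nodup_append hnd ha (by simp)
    have h2 : a ∉ p' := fun ha => List.disjoint_of_nodup_append hnd' ha (by simp)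
    have hp2 : p.length = p'.length := by
      have i1 : (p ++ a :: q).idxOf a = p.length := by simp [List.idxOf_append_of_notMem h1]
      have i2 : (p' ++ a :: q').idxOf a = p'.length := by simp [List.idxOf_append_of_notMem h2]
      rw [← i1, ← i2, e]
    obtain ⟨e1, e2⟩ := List.append_inj e hp2
    rw [e1, e2]
  · intro v hv
    rw [Finset.mem_sdiff] at hv
    obtain ⟨r, hr, hvr⟩ := h.cover v
    obtain ⟨p, q, rfl⟩ := List.append_of_mem hvr
    have hp : p ≠ [] := by
      rintro rfl
      exact hv.2 (Finset.mem_filter.2 ⟨Finset.mem_univ _, _, hr, by simp⟩)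
    exact ⟨(p, v :: q), mem_splits.2 ⟨hp, by simp, hr⟩, by simp⟩

lemma IsPathFamily.merge {p q : List V} (h : G.IsPathFamily L)
    (hp : p ∈ L) (hq : q ∈ L) {u v : V} (hu : p.getLast? = some u) (hv : q.head? = some v)
    (huv : G.Adj u v) (hpq : p ≠ q) :
    G.IsPathFamily (insert (p ++ q) ((L.erase p).erase q)) := by
  have hdis : p.Disjoint q := fun x hx hx' => hpq (h.eq_of_mem p hp q hq x hx hx')
  have key : ∀ r ∈ L, ∀ x, x ∈ r → x ∈ p ++ q → r = p ∨ r = q := by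
    intro r hr x hx hx'
    rcases List.mem_append.1 hx' with hx' | hx'
    · exact Or.inl (h.eq_of_mem r hr p hp x hx hx')
    · exact Or.inr (h.eq_of_mem r hr q hq x hx hx')
  refine ⟨?_, ?_, ?_, ?_, ?_⟩
  · intro r hr
    rcases Finset.mem_insert.1 hr with rfl | hr
    · simp [h.ne_nil p hp]
    · exact h.ne_nil r (Finset.mem_of_mem_erase (Finset.mem_of_mem_erase hr))
  · intro r hr
    rcases Finset.mem_insert.1 hr with rfl | hr
    · exact List.Nodup.append (h.nodup p hp) (h.nodup q hq) hdis
    · exact h.nodup r (Finset.mem_of_mem_erase (Finset.mem_of_mem_erase hr))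
  · intro r hr
    rcases Finset.mem_insert.1 hr with rfl | hr
    · rw [List.isChain_append]
      refine ⟨h.chain p hp, h.chain q hq, ?_⟩
      intro x hx y hy
      rwa [Option.mem_unique hx hu, Option.mem_unique hy hv]
    · exact h.chain r (Finset.mem_of_mem_erase (Finset.mem_of_mem_erase hr))
  · intro x
    obtain ⟨r, hr, hx⟩ := h.cover x
    by_cases hrp : r = p
    · exact ⟨p ++ q, Finset.mem_insert_self _ _, List.mem_append_left _ (hrp ▸ hx)⟩
    by_cases hrq : r = q
    · exact ⟨p ++ q, Finset.mem_insert_self _ _, List.mem_append_right _ (hrq ▸ hx)⟩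
    exact ⟨r, Finset.mem_insert_of_mem (Finset.mem_erase.2 ⟨hrq, Finset.mem_erase.2 ⟨hrp, hr⟩⟩), hx⟩
  · intro r hr s hs x hxr hxs
    rcases Finset.mem_insert.1 hr with rfl | hr <;> rcases Finset.mem_insert.1 hs with rfl | hs
    · rfl
    · simp only [Finset.mem_erase] at hs
      rcases key s hs.2.2 x hxs hxr with h | h
      exacts [absurd h hs.2.1, absurd h hs.1]
    · simp only [Finset.mem_erase] at hr
      rcases key r hr.2.2 x hxr hxs with h | h
      exacts [absurd h hr.2.1, absurd h hr.1]
    · exact h.eq_of_mem r (Finset.mem_of_mem_erase (Finset.mem_of_mem_erase hr)) s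
        (Finset.mem_of_mem_erase (Finset.mem_of_mem_erase hs)) x hxr hxs

lemma IsPathFamily.append_notMem {p q : List V} (h : G.IsPathFamily L)
    (hp : p ∈ L) (hq : q ∈ L) : p ++ q ∉ L := by
  intro hmem
  obtain ⟨x, hx⟩ := List.exists_mem_of_ne_nil p (h.ne_nil p hp)
  have := h.eq_of_mem _ hmem p hp x (List.mem_append_left _ hx) hx
  exact h.ne_nil q hq (by simpa using this)

lemma IsPathFamily.split {p q : List V} (h : G.IsPathFamily L) (hp : p ≠ []) (hq : q ≠ [])
    (hpq : p ++ q ∈ L) : G.IsPathFamily (insert p (insert q (L.erase (p ++ q)))) := by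
  have hnd := h.nodup _ hpq
  have hdis : p.Disjoint q := List.disjoint_of_nodup_append hnd
  have hch := List.isChain_append.1 (h.chain _ hpq)
  have hin : ∀ r ∈ insert p (insert q (L.erase (p ++ q))),
      (r = p ∨ r = q) ∨ r ∈ L ∧ r ≠ p ++ q := by
    intro r hr
    simp only [Finset.mem_insert, Finset.mem_erase] at hr
    tauto
  have key : ∀ r ∈ L, r ≠ p ++ q → ∀ x ∈ r, x ∉ p ++ q :=
    fun r hr hne x hx hx' => hne (h.eq_of_mem r hr _ hpq x hx hx')
  refine ⟨?_, ?_, ?_, ?_, ?_⟩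
  · intro r hr
    rcases hin r hr with (rfl | rfl) | hr
    exacts [hp, hq, h.ne_nil r hr.1]
  · intro r hr
    rcases hin r hr with (rfl | rfl) | hr
    exacts [hnd.of_append_left, hnd.of_append_right, h.nodup r hr.1]
  · intro r hr
    rcases hin r hr with (rfl | rfl) | hr
    exacts [hch.1, hch.2.1, h.chain r hr.1]
  · intro x
    obtain ⟨r, hr, hx⟩ := h.cover x
    by_cases hrpq : r = p ++ q
    · subst hrpq
      rcases List.mem_append.1 hx with hx | hx
      · exact ⟨p, by simp, hx⟩
      · exact ⟨q, by simp, hx⟩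
    · exact ⟨r, by simp [hr, hrpq], hx⟩
  · intro r hr s hs x hxr hxs
    rcases hin r hr with (rfl | rfl) | hr <;> rcases hin s hs with (rfl | rfl) | hs
    · rfl
    · exact absurd hxs (hdis hxr)
    · exact absurd (List.mem_append_left _ hxr) (key s hs.1 hs.2 x hxs)
    · exact absurd hxr (hdis hxs)
    · rfl
    · exact absurd (List.mem_append_right _ hxr) (key s hs.1 hs.2 x hxs)
    · exact absurd (List.mem_append_left _ hxs) (key r hr.1 hr.2 x hxr)
    · exact absurd (List.mem_append_right _ hxs) (key r hr.1 hr.2 x hxr)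
    · exact h.eq_of_mem r hr.1 s hs.1 x hxr hxs

lemma IsPathFamily.notMem_of_append_mem {p q : List V} (h : G.IsPathFamily L) (hp : p ≠ [])
    (hq : q ≠ []) (hpq : p ++ q ∈ L) : p ∉ L ∧ q ∉ L := by
  constructor
  · intro hmem
    obtain ⟨x, hx⟩ := List.exists_mem_of_ne_nil p hp
    have := h.eq_of_mem _ hpq p hmem x (List.mem_append_left _ hx) hx
    exact hq (by simpa using this)
  · intro hmem
    obtain ⟨x, hx⟩ := List.exists_mem_of_ne_nil q hq
    have := h.eq_of_mem _ hpq q hmem x (List.mem_append_right _ hx) hx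
    exact hp (by simpa using this)

variable [DecidableRel G.Adj]

/-- Double counting of pairs of families related by concatenating two paths. -/
lemma sum_card_merges (j : ℕ) :
    ∑ L ∈ G.pathFamilies (j + 1), (G.merges L).card =
      (G.pathFamilies j).card * (Fintype.card V - j) := by
  have h1 : (G.pathFamilies j).card * (Fintype.card V - j) =
      ∑ L ∈ G.pathFamilies j, (splits L).card := by
    symm
    refine Finset.sum_const_nat fun L hL => ?_
    rw [mem_pathFamilies] at hL
    rw [hL.1.card_splits, hL.2]
  rw [h1, ← Finset.card_sigma, ← Finset.card_sigma]
  refine Finset.card_bij'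
    (fun x _ => ⟨insert (x.2.1 ++ x.2.2) ((x.1.erase x.2.1).erase x.2.2), x.2⟩)
    (fun x _ => ⟨insert x.2.1 (insert x.2.2 (x.1.erase (x.2.1 ++ x.2.2))), x.2⟩) ?_ ?_ ?_ ?_
  · rintro ⟨L, p, q⟩ hx
    simp only [Finset.mem_sigma, mem_pathFamilies, merges, Finset.mem_filter,
      Finset.mem_product] at hx
    obtain ⟨⟨hL, hLc⟩, ⟨hp, hq⟩, hpq, u, v, hu, hv, huv⟩ := hx
    simp only [Finset.mem_sigma, mem_pathFamilies, mem_splits]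
    refine ⟨⟨hL.merge hp hq hu hv huv hpq, ?_⟩, hL.ne_nil p hp, hL.ne_nil q hq, by simp⟩
    rw [Finset.card_insert_of_notMem, Finset.card_erase_of_mem, Finset.card_erase_of_mem hp, hLc]
    · have : 1 < L.card := Finset.one_lt_card.2 ⟨p, hp, q, hq, hpq⟩
      omega
    · exact Finset.mem_erase.2 ⟨hpq.symm, hq⟩
    · intro hcon
      exact hL.append_notMem hp hq (Finset.mem_of_mem_erase (Finset.mem_of_mem_erase hcon))
  · rintro ⟨L, p, q⟩ hx
    simp only [Finset.mem_sigma, mem_pathFamilies, mem_splits] at hx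
    obtain ⟨⟨hL, hLc⟩, hp, hq, hpq⟩ := hx
    have hnm := hL.notMem_of_append_mem hp hq hpq
    have hne : p ≠ q := by
      rintro rfl
      obtain ⟨x, hx⟩ := List.exists_mem_of_ne_nil p hp
      exact List.disjoint_of_nodup_append (hL.nodup _ hpq) hx hx
    simp only [Finset.mem_sigma, mem_pathFamilies, merges, Finset.mem_filter, Finset.mem_product]
    refine ⟨⟨hL.split hp hq hpq, ?_⟩, ⟨by simp, by simp⟩, hne, p.getLast hp, q.head hq,
      List.getLast?_eq_getLast_of_ne_nil hp, List.head?_eq_some_head hq, ?_⟩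
    · rw [Finset.card_insert_of_notMem, Finset.card_insert_of_notMem, Finset.card_erase_of_mem hpq,
        hLc]
      · have : 0 < L.card := Finset.card_pos.2 ⟨_, hpq⟩
        omega
      · exact fun hcon => hnm.2 (Finset.mem_of_mem_erase hcon)
      · rw [Finset.mem_insert, not_or]
        exact ⟨hne, fun hcon => hnm.1 (Finset.mem_of_mem_erase hcon)⟩
    · exact (List.isChain_append.1 (hL.chain _ hpq)).2.2 _ (List.getLast?_eq_getLast_of_ne_nil hp) _
        (List.head?_eq_some_head hq)
  · rintro ⟨L, p, q⟩ hx
    simp only [Finset.mem_sigma, mem_pathFamilies, merges, Finset.mem_filter,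
      Finset.mem_product] at hx
    obtain ⟨⟨hL, hLc⟩, ⟨hp, hq⟩, hpq, u, v, hu, hv, huv⟩ := hx
    simp only [Sigma.mk.injEq, heq_eq_eq, and_true]
    rw [Finset.erase_insert, Finset.insert_erase, Finset.insert_erase hp]
    · exact Finset.mem_erase.2 ⟨hpq.symm, hq⟩
    · intro hcon
      exact hL.append_notMem hp hq (Finset.mem_of_mem_erase (Finset.mem_of_mem_erase hcon))
  · rintro ⟨L, p, q⟩ hx
    simp only [Finset.mem_sigma, mem_pathFamilies, mem_splits] at hx
    obtain ⟨⟨hL, hLc⟩, hp, hq, hpq⟩ := hx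
    have hnm := hL.notMem_of_append_mem hp hq hpq
    have hne : p ≠ q := by
      rintro rfl
      obtain ⟨x, hx⟩ := List.exists_mem_of_ne_nil p hp
      exact List.disjoint_of_nodup_append (hL.nodup _ hpq) hx hx
    simp only [Sigma.mk.injEq, heq_eq_eq, and_true]
    rw [Finset.erase_insert, Finset.erase_insert, Finset.insert_erase hpq]
    · exact fun hcon => hnm.2 (Finset.mem_of_mem_erase hcon)
    · rw [Finset.mem_insert, not_or]
      exact ⟨hne, fun hcon => hnm.1 (Finset.mem_of_mem_erase hcon)⟩

/-- The edges from last to first vertices are the merges, plus at most one edge for each path from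
its own end to its own start. -/
lemma IsPathFamily.card_merges (h : G.IsPathFamily L) :
    (G.merges L).card ≤ (G.interedges (lasts L) (heads L)).card ∧
      (G.interedges (lasts L) (heads L)).card ≤ (G.merges L).card + L.card := by
  have hbij : (G.interedges (lasts L) (heads L)).card = ((L ×ˢ L).filter fun x =>
      ∃ u v, x.1.getLast? = some u ∧ x.2.head? = some v ∧ G.Adj u v).card := by
    symm
    have hmem : ∀ {x : List V × List V}, x ∈ ((L ×ˢ L).filter fun x =>
      ∃ u v, x.1.getLast? = some u ∧ x.2.head? = some v ∧ G.Adj u v) → x.1 ≠ [] ∧ x.2 ≠ [] := by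
      intro x hx
      rw [Finset.mem_filter, Finset.mem_product] at hx
      exact ⟨h.ne_nil _ hx.1.1, h.ne_nil _ hx.1.2⟩
    refine Finset.card_bij (fun x hx => (x.1.getLast (hmem hx).1, x.2.head (hmem hx).2)) ?_ ?_ ?_
    · rintro ⟨p, q⟩ hx
      have hne := hmem hx
      rw [Finset.mem_filter, Finset.mem_product] at hx
      obtain ⟨⟨hp, hq⟩, u, v, hu, hv, huv⟩ := hx
      simp only at hp hq hu hv hne
      rw [List.getLast?_eq_getLast_of_ne_nil hne.1, Option.some.injEq] at hu
      rw [List.head?_eq_some_head hne.2, Option.some.injEq] at hv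
      rw [mem_interedges_iff]
      refine ⟨Finset.mem_filter.2 ⟨Finset.mem_univ _, p, hp,
        List.getLast?_eq_getLast_of_ne_nil hne.1⟩, Finset.mem_filter.2 ⟨Finset.mem_univ _, q, hq,
        List.head?_eq_some_head hne.2⟩, ?_⟩
      simp only [hu, hv]
      exact huv
    · rintro ⟨p, q⟩ hx ⟨p', q'⟩ hx' heq
      have hne := hmem hx
      have hne' := hmem hx'
      rw [Finset.mem_filter, Finset.mem_product] at hx hx'
      simp only [Prod.mk.injEq] at heq ⊢
      exact ⟨h.eq_of_mem p hx.1.1 p' hx'.1.1 _ (List.getLast_mem hne.1)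
        (heq.1 ▸ List.getLast_mem hne'.1), h.eq_of_mem q hx.1.2 q' hx'.1.2 _ (List.head_mem hne.2)
        (heq.2 ▸ List.head_mem hne'.2)⟩
    · rintro ⟨u, v⟩ huv
      rw [mem_interedges_iff] at huv
      obtain ⟨hu, hv, huv⟩ := huv
      obtain ⟨p, hp, hpu⟩ := (Finset.mem_filter.1 hu).2
      obtain ⟨q, hq, hqv⟩ := (Finset.mem_filter.1 hv).2
      refine ⟨(p, q), Finset.mem_filter.2 ⟨Finset.mem_product.2 ⟨hp, hq⟩, u, v, hpu, hqv, huv⟩, ?_⟩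
      rw [List.getLast?_eq_getLast_of_ne_nil (h.ne_nil p hp), Option.some.injEq] at hpu
      rw [List.head?_eq_some_head (h.ne_nil q hq), Option.some.injEq] at hqv
      simp only [hpu, hqv]
  rw [hbij]
  constructor
  · apply Finset.card_le_card
    intro x hx
    rw [merges, Finset.mem_filter] at hx
    exact Finset.mem_filter.2 ⟨hx.1, hx.2.2⟩
  · have hsub : ((L ×ˢ L).filter fun x =>
        ∃ u v, x.1.getLast? = some u ∧ x.2.head? = some v ∧ G.Adj u v) ⊆
        G.merges L ∪ L.image fun p => (p, p) := by
      intro x hx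
      rw [Finset.mem_filter, Finset.mem_product] at hx
      rw [Finset.mem_union]
      by_cases hxx : x.1 = x.2
      · exact Or.inr (Finset.mem_image.2 ⟨x.1, hx.1.1, Prod.ext rfl hxx⟩)
      · exact Or.inl (Finset.mem_filter.2 ⟨Finset.mem_product.2 hx.1, hxx, hx.2⟩)
    exact (Finset.card_le_card hsub).trans ((Finset.card_union_le _ _).trans
      (Nat.add_le_add_left Finset.card_image_le _))

variable {d μ : ℝ}

lemma Mixing.card_merges_le (h : G.Mixing d μ) (hL : L ∈ G.pathFamilies j) :
    ((G.merges L).card : ℝ) ≤ j * (d * j / Fintype.card V + μ) := by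
  rw [mem_pathFamilies] at hL
  have h1 := h.le (lasts L) (heads L)
  rw [hL.1.card_lasts, hL.1.card_heads, hL.2, Real.sqrt_mul_self (Nat.cast_nonneg j)] at h1
  have h2 : ((G.merges L).card : ℝ) ≤ (G.interedges (lasts L) (heads L)).card := by
    exact_mod_cast hL.1.card_merges.1
  calc _ ≤ _ := h2.trans h1
    _ = _ := by ring

lemma Mixing.le_card_merges (h : G.Mixing d μ) (hL : L ∈ G.pathFamilies j) :
    j * (d * j / Fintype.card V - (μ + 1)) ≤ ((G.merges L).card : ℝ) := by
  rw [mem_pathFamilies] at hL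
  have h1 := h.ge (lasts L) (heads L)
  rw [hL.1.card_lasts, hL.1.card_heads, hL.2, Real.sqrt_mul_self (Nat.cast_nonneg j)] at h1
  have h2 : ((G.interedges (lasts L) (heads L)).card : ℝ) ≤ (G.merges L).card + j := by
    rw [← hL.2]
    exact_mod_cast hL.1.card_merges.2
  have e : j * (d * j / Fintype.card V - (μ + 1)) =
    d * j * j / Fintype.card V - μ * j - (j : ℝ) := by ring
  rw [e]
  linarith

end SimpleGraph

/-! ### Numbers of path families, and their relation to orderings and cycles -/

namespace SimpleGraph

variable {V : Type*} [DecidableEq V] [Fintype V] {G : SimpleGraph V} [DecidableRel G.Adj]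
  {d μ : ℝ}

/-- With as many paths as vertices, every vertex starts its path. This is the base of both descents
below. -/
lemma pathFamilies_card : G.pathFamilies (Fintype.card V) =
    {Finset.univ.image fun v : V => [v]} := by
  ext L
  rw [mem_pathFamilies, Finset.mem_singleton]
  constructor
  · rintro ⟨h, hc⟩
    have hheads : heads L = Finset.univ := by
      rw [← Finset.card_eq_iff_eq_univ, h.card_heads, hc]
    have key : ∀ v, ∀ p ∈ L, v ∈ p → p = [v] := by
      intro v p hp hv
      have hhead : ∀ w ∈ p, p.head? = some w := by
        intro w hw
        have : w ∈ heads L := hheads ▸ Finset.mem_univ w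
        obtain ⟨q, hq, hqw⟩ := (Finset.mem_filter.1 this).2
        rw [h.eq_of_mem p hp q hq w hw (List.mem_of_mem_head? hqw)]
        exact hqw
      cases p with
      | nil => simp at hv
      | cons a p =>
        have hnd := h.nodup _ hp
        cases p with
        | nil => simp at hv; rw [hv]
        | cons b p =>
          have := hhead b (by simp)
          simp only [List.head?_cons, Option.some.injEq] at this
          simp [this] at hnd
    ext p
    simp only [Finset.mem_image, Finset.mem_univ, true_and]
    constructor
    · intro hp
      obtain ⟨v, hv⟩ := List.exists_mem_of_ne_nil p (h.ne_nil p hp)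
      exact ⟨v, (key v p hp hv).symm⟩
    · rintro ⟨v, rfl⟩
      obtain ⟨p, hp, hv⟩ := h.cover v
      rwa [← key v p hp hv]
  · rintro rfl
    refine ⟨⟨?_, ?_, ?_, ?_, ?_⟩, ?_⟩
    · simp
    · simp
    · simp
    · exact fun v => ⟨[v], by simp, by simp⟩
    · simp only [Finset.mem_image, Finset.mem_univ, true_and]
      rintro _ ⟨a, rfl⟩ _ ⟨b, rfl⟩ v hv hv'
      simp only [List.mem_singleton] at hv hv'
      rw [← hv, ← hv']
    · rw [Finset.card_image_of_injective _ (fun a b h => by simpa using h), Finset.card_univ]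

lemma choose_succ_mul (n j : ℕ) (hj : j ≤ n) :
    (n.choose (j + 1) : ℝ) * ((j + 1 : ℕ) : ℝ) = n.choose j * ((n : ℝ) - j) := by
  have := Nat.choose_succ_right_eq n j
  rw [← Nat.cast_sub hj]
  exact_mod_cast this

lemma card_pathFamilies_mul {j : ℕ} (hj : j ≤ Fintype.card V) :
    ∑ L ∈ G.pathFamilies (j + 1), ((G.merges L).card : ℝ) =
      (G.pathFamilies j).card * ((Fintype.card V : ℝ) - j) := by
  rw [← Nat.cast_sub hj]
  exact_mod_cast sum_card_merges (G := G) j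

lemma prod_Ioc_succ {f : ℕ → ℝ} {j n : ℕ} (hj : j < n) :
    ∏ i ∈ Finset.Ioc j n, f i = f (j + 1) * ∏ i ∈ Finset.Ioc (j + 1) n, f i := by
  have : Finset.Ioc j n = insert (j + 1) (Finset.Ioc (j + 1) n) := by
    ext i
    simp only [Finset.mem_Ioc, Finset.mem_insert]
    omega
  rw [this, Finset.prod_insert (by simp)]

/-- Downward induction on `j`: each step multiplies by the merge bound over n - j, and the binomial
coefficient absorbs the ratio (j+1)/(n-j). -/
lemma Mixing.card_pathFamilies_le (h : G.Mixing d μ) (hd : 0 ≤ d) (hμ : 0 ≤ μ) {j : ℕ}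
    (hj : j ≤ Fintype.card V) :
    ((G.pathFamilies j).card : ℝ) ≤ (Fintype.card V).choose j *
      ∏ i ∈ Finset.Ioc j (Fintype.card V), (d * i / Fintype.card V + μ) := by
  set n := Fintype.card V with hn
  induction hj using Nat.decreasingInduction with
  | self => rw [hn, pathFamilies_card]; simp
  | of_succ j hj ih =>
    have hpos : (0 : ℝ) < (n : ℝ) - j := by
      rw [sub_pos]; exact_mod_cast hj
    refine le_of_mul_le_mul_right ?_ hpos
    rw [← card_pathFamilies_mul hj.le]
    calc _ ≤ ∑ L ∈ G.pathFamilies (j + 1), ((j + 1 : ℕ) : ℝ) * (d * ((j + 1 : ℕ) : ℝ) / n + μ) :=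
          Finset.sum_le_sum fun L hL => h.card_merges_le hL
      _ = (G.pathFamilies (j + 1)).card * (((j + 1 : ℕ) : ℝ) * (d * ((j + 1 : ℕ) : ℝ) / n + μ)) := by
          simp
      _ ≤ (n.choose (j + 1) * ∏ i ∈ Finset.Ioc (j + 1) n, (d * i / n + μ)) *
          (((j + 1 : ℕ) : ℝ) * (d * ((j + 1 : ℕ) : ℝ) / n + μ)) := by gcongr
      _ = (n.choose (j + 1) * ((j + 1 : ℕ) : ℝ)) *
          ((d * ((j + 1 : ℕ) : ℝ) / n + μ) * ∏ i ∈ Finset.Ioc (j + 1) n, (d * i / n + μ)) := by ring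
      _ = _ := by
          rw [choose_succ_mul n j hj.le, prod_Ioc_succ hj]; ring

/-- The same descent with the lower merge bound. The condition at `m` keeps every factor
nonnegative, so the inequalities may be multiplied. -/
lemma Mixing.le_card_pathFamilies (h : G.Mixing d μ) {m : ℕ} (hd : 0 ≤ d)
    (hm : μ + 1 ≤ d * m / Fintype.card V) (hmn : m ≤ Fintype.card V) :
    ((Fintype.card V).choose m : ℝ) *
      ∏ i ∈ Finset.Ioc m (Fintype.card V), (d * i / Fintype.card V - (μ + 1)) ≤
      (G.pathFamilies m).card := by
  set n := Fintype.card V with hn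
  have hnonneg : ∀ i, m ≤ i → 0 ≤ d * i / n - (μ + 1) := by
    intro i hi
    have : d * m / n ≤ d * i / n := by gcongr
    linarith
  suffices ∀ j ≤ n, m ≤ j → (n.choose j : ℝ) *
      ∏ i ∈ Finset.Ioc j n, (d * i / n - (μ + 1)) ≤ (G.pathFamilies j).card from
    this m hmn le_rfl
  intro j hj
  induction hj using Nat.decreasingInduction with
  | self => intro _; rw [hn, pathFamilies_card]; simp
  | of_succ j hj ih =>
    intro hmj
    have hpos : (0 : ℝ) < (n : ℝ) - j := by
      rw [sub_pos]; exact_mod_cast hj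
    refine le_of_mul_le_mul_right ?_ hpos
    rw [← card_pathFamilies_mul hj.le]
    have ih' := ih (by omega)
    have h0 := hnonneg (j + 1) (by omega)
    calc _ = (n.choose (j + 1) * ((j + 1 : ℕ) : ℝ)) * ((d * ((j + 1 : ℕ) : ℝ) / n - (μ + 1)) *
          ∏ i ∈ Finset.Ioc (j + 1) n, (d * i / n - (μ + 1))) := by
          rw [choose_succ_mul n j hj.le, prod_Ioc_succ hj]; ring
      _ = (n.choose (j + 1) * ∏ i ∈ Finset.Ioc (j + 1) n, (d * i / n - (μ + 1))) *
          (((j + 1 : ℕ) : ℝ) * (d * ((j + 1 : ℕ) : ℝ) / n - (μ + 1))) := by ring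
      _ ≤ (G.pathFamilies (j + 1)).card *
          (((j + 1 : ℕ) : ℝ) * (d * ((j + 1 : ℕ) : ℝ) / n - (μ + 1))) := by gcongr
      _ = ∑ L ∈ G.pathFamilies (j + 1),
          ((j + 1 : ℕ) : ℝ) * (d * ((j + 1 : ℕ) : ℝ) / n - (μ + 1)) := by simp
      _ ≤ _ := Finset.sum_le_sum fun L hL => h.le_card_merges hL

/-- Non-edges can occur only at the junctions of consecutive lists. -/
lemma card_badEdges_flatten_le (Ls : List (List V)) (h : ∀ p ∈ Ls, p.IsChain G.Adj) :
    (G.badEdges Ls.flatten).card ≤ Ls.length := by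
  induction Ls with
  | nil => simp [badEdges]
  | cons p Ls ih =>
    have ih' := ih fun q hq => h q (by simp [hq])
    set D : Finset (Sym2 V) := p.getLast?.toFinset.biUnion fun x =>
      Ls.flatten.head?.toFinset.image fun y => s(x, y)
    have hD : D.card ≤ 1 := by
      simp only [D]
      cases p.getLast? <;> cases Ls.flatten.head? <;> simp
    have hsub : G.badEdges (p :: Ls).flatten ⊆ G.badEdges Ls.flatten ∪ D := by
      intro e he
      rw [badEdges, Finset.mem_filter, List.flatten_cons, List.mem_pathEdges_append] at he
      rw [Finset.mem_union]
      rcases he with ⟨he | he | ⟨x, hx, y, hy, rfl⟩, hG⟩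
      · exact absurd (List.isChain_adj_iff.1 (h p (by simp)) e he) hG
      · exact Or.inl (Finset.mem_filter.2 ⟨he, hG⟩)
      · refine Or.inr (Finset.mem_biUnion.2 ⟨x, by simpa using hx,
          Finset.mem_image.2 ⟨y, by simpa using hy, rfl⟩⟩)
    have h1 := Finset.card_le_card hsub
    have h2 := Finset.card_union_le (G.badEdges Ls.flatten) D
    simp only [List.length_cons]
    omega

lemma IsPathFamily.flatten_mem_orderings {L : Finset (List V)} (h : G.IsPathFamily L) :
    L.toList.flatten ∈ orderings V := by
  rw [mem_orderings]
  constructor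
  · rw [List.nodup_flatten]
    refine ⟨fun p hp => h.nodup p (by simpa using hp), ?_⟩
    refine (Finset.nodup_toList L).pairwise_of_forall_ne ?_
    intro p hp q hq hpq v hvp hvq
    exact hpq (h.eq_of_mem p (by simpa using hp) q (by simpa using hq) v hvp hvq)
  · intro v
    obtain ⟨p, hp, hv⟩ := h.cover v
    exact List.mem_flatten.2 ⟨p, by simpa using hp, hv⟩

/-- Few families of `m` paths yield the same ordering when concatenated. -/
lemma card_pathFamilies_le_mul (m : ℕ) :
    (G.pathFamilies m).card ≤ ((orderings V).filter fun l => (G.badEdges l).card ≤ m).card *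
      (Fintype.card V + 1) ^ m := by
  set n := Fintype.card V with hn
  have hlen : ∀ L ∈ G.pathFamilies m, ∀ p ∈ L.toList, p.length < n + 1 := by
    intro L hL p hp
    rw [mem_pathFamilies] at hL
    rw [Nat.lt_succ_iff]
    exact (hL.1.nodup p (by simpa using hp)).length_le_card
  calc _ ≤ (((orderings V).filter fun l => (G.badEdges l).card ≤ m) ×ˢ
        (Finset.univ : Finset (Fin m → Fin (n + 1)))).card := by
        -- A concatenation and the lengths of its pieces determine the pieces. Lengths are below n +
        -- 1 and indices below the number of paths, so neither `Fin.ofNat` nor the default 0 loses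
        -- information.
        refine Finset.card_le_card_of_injOn (fun L => (L.toList.flatten,
          fun i => Fin.ofNat (n + 1) ((L.toList.map List.length)[(i : ℕ)]?.getD 0))) ?_ ?_
        · intro L hL
          rw [Finset.mem_coe] at hL
          have hL' := mem_pathFamilies.1 hL
          simp only [Finset.coe_product, Set.mem_prod, Finset.mem_coe, Finset.mem_filter,
            Finset.mem_univ, and_true]
          refine ⟨hL'.1.flatten_mem_orderings, ?_⟩
          have := card_badEdges_flatten_le (G := G) L.toList
            (fun p hp => hL'.1.chain p (by simpa using hp))
          rwa [Finset.length_toList, hL'.2] at this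
        · intro L hL L' hL' heq
          rw [Finset.mem_coe] at hL hL'
          simp only [Prod.mk.injEq] at heq
          have hc := (mem_pathFamilies.1 hL).2
          have hc' := (mem_pathFamilies.1 hL').2
          have : L.toList = L'.toList := by
            rw [List.eq_iff_flatten_eq]
            refine ⟨heq.1, ?_⟩
            apply List.ext_getElem
            · simp [hc, hc']
            · intro i h1 h2
              have him : i < m := by simpa [hc] using h1
              have := congrArg Fin.val (congrFun heq.2 ⟨i, him⟩)
              simp only [Fin.val_ofNat, List.getElem?_eq_getElem h1, List.getElem?_eq_getElem h2,
                Option.getD_some, List.getElem_map] at this ⊢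
              rwa [Nat.mod_eq_of_lt (hlen L hL _ (List.getElem_mem _)),
                Nat.mod_eq_of_lt (hlen L' hL' _ (List.getElem_mem _))] at this
          rw [← Finset.toList_toFinset L, this, Finset.toList_toFinset]
    _ = _ := by simp [Finset.card_product]

lemma Walk.mem_edges_iff_mem_pathEdges {u v : V} (p : G.Walk u v) (e : Sym2 V) :
    e ∈ p.edges ↔ e ∈ p.support.pathEdges := by
  induction p with
  | nil => simp
  | @cons u v w h p ih =>
    rw [Walk.edges_cons, List.mem_cons, ih, Walk.support_cons, List.mem_pathEdges_cons]
    have : p.support.head? = some v := by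
      rw [List.head?_eq_some_head p.support_ne_nil]; simp
    rw [this]
    simp [or_comm]

/-- A Hamilton cycle is determined by its list of vertices. -/
lemma numHamiltonCycles_le : G.numHamiltonCycles ≤ (G.pathFamilies 1).card := by
  have hex : ∀ H ∈ {H : G.Subgraph | ∃ (v : V) (p : G.Walk v v),
      p.IsHamiltonianCycle ∧ p.toSubgraph = H}, ∃ t : List V, {t} ∈ G.pathFamilies 1 ∧
      ∃ (v : V) (p : G.Walk v v), p.support = v :: t ∧ t.getLast? = some v ∧ p.toSubgraph = H := by
    rintro H ⟨v, p, hp, rfl⟩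
    have hcount := (Walk.isHamiltonianCycle_iff_isCycle_and_support_count_tail_eq_one.1 hp).2
    have hne : p.support.tail ≠ [] := by
      have := hcount v
      intro h0
      rw [h0] at this
      simp at this
    -- The tail of the support lists every vertex once and ends at the base point, so it determines
    -- the closed walk.
    refine ⟨p.support.tail, mem_pathFamilies.2 ⟨⟨?_, ?_, ?_, ?_, ?_⟩, by simp⟩, v, p,
      (Walk.cons_tail_support p).symm, ?_, rfl⟩
    · simpa using hne
    · simpa using hp.isCycle.support_nodup
    · simpa using p.isChain_adj_support.tail
    · exact fun w => ⟨p.support.tail, by simp, List.count_pos_iff.1 (by rw [hcount w]; simp)⟩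
    · simp only [Finset.mem_singleton]
      rintro a rfl b rfl _ _ _; rfl
    · rw [List.getLast?_eq_getLast_of_ne_nil hne, List.getLast_tail, Walk.getLast_support]
  choose! f hf hf' using hex
  rw [numHamiltonCycles, ← Set.ncard_coe_finset]
  refine Set.ncard_le_ncard_of_injOn (fun H => {f H}) hf ?_
  intro H hH H' hH' heq
  simp only [Finset.singleton_inj] at heq
  obtain ⟨v, p, hps, hpv, hpH⟩ := hf' H hH
  obtain ⟨v', p', hps', hpv', hpH'⟩ := hf' H' hH'
  rw [← heq] at hps' hpv'
  have hvv : v = v' := by simpa [hpv] using hpv'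
  subst hvv
  have : p = p' := Walk.ext_support (hps.trans hps'.symm)
  rw [← hpH, ← hpH', this]

/-- Each Hamilton cycle accounts for few cyclic orderings. -/
lemma card_cyclicOrderings_le (h3 : 3 ≤ Fintype.card V) :
    G.cyclicOrderings.card ≤ G.numHamiltonCycles * (Fintype.card V + 1) ^ 2 := by
  classical
  set S := {H : G.Subgraph | ∃ (v : V) (p : G.Walk v v),
      p.IsHamiltonianCycle ∧ p.toSubgraph = H} with hS
  have hex : ∀ l ∈ G.cyclicOrderings, ∃ H ∈ S, ∀ u v, l.head? = some u → l.getLast? = some v →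
      ∀ e, e ∈ l.pathEdges ↔ e ∈ H.edgeSet ∧ e ≠ s(v, u) := by
    intro l hl
    rw [cyclicOrderings, Finset.mem_filter] at hl
    obtain ⟨hlo, hlG, u, hu, v, hv, huv⟩ := hl
    have hlen := length_of_mem_orderings hlo
    rw [mem_orderings] at hlo
    have hne : l ≠ [] := by rintro rfl; simp at hu
    have hu' : l.head hne = u := by simpa [List.head?_eq_some_head hne] using hu
    have hv' : l.getLast hne = v := by simpa [List.getLast?_eq_getLast_of_ne_nil hne] using hv
    obtain ⟨p, hp⟩ : ∃ p : G.Walk u v, p.support = l := by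
      subst hu' hv'
      exact ⟨Walk.ofSupport l hne (List.isChain_adj_iff.2 hlG), Walk.support_ofSupport _ _⟩
    -- This needs three vertices: on two, the closing pair would repeat the only edge.
    have hnot : s(v, u) ∉ l.pathEdges := by
      intro hcon
      obtain ⟨a, l, rfl⟩ := List.exists_cons_of_ne_nil hne
      simp only [List.head_cons] at hu'
      subst hu'
      rw [Sym2.eq_swap] at hcon
      have h1 := (List.mem_pathEdges_iff_of_nodup (A := []) hlo.1).1 hcon
      simp only [List.getLast?_nil, reduceCtorEq, false_or] at h1
      match l, h1 with
      | [b], h1 => simp at hlen; omega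
      | b :: c :: l, h1 =>
        simp only [List.head?_cons, Option.some.injEq] at h1
        subst h1
        have hb : b ∈ c :: l := by
          rw [List.getLast?_cons_cons, List.getLast?_cons_cons] at hv
          exact List.mem_of_mem_getLast? hv
        exact (List.nodup_cons.1 hlo.1.of_cons).1 hb
    have hcyc : (Walk.cons huv.symm p).IsHamiltonianCycle := by
      rw [Walk.isHamiltonianCycle_iff_isCycle_and_support_count_tail_eq_one, Walk.cons_isCycle_iff]
      refine ⟨⟨?_, ?_⟩, ?_⟩
      · rw [Walk.isPath_def, hp]; exact hlo.1
      · rw [Walk.mem_edges_iff_mem_pathEdges, hp]; exact hnot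
      · intro a
        rw [Walk.support_cons, List.tail_cons, hp]
        exact List.count_eq_one_of_mem hlo.1 (hlo.2 a)
    refine ⟨_, ⟨v, _, hcyc, rfl⟩, ?_⟩
    intro u₁ v₁ hu₁ hv₁ e
    rw [Option.mem_unique hu₁ hu, Option.mem_unique hv₁ hv, Walk.mem_edges_toSubgraph,
      Walk.edges_cons, List.mem_cons, Walk.mem_edges_iff_mem_pathEdges, hp]
    constructor
    · intro he
      exact ⟨Or.inr he, fun h => hnot (h ▸ he)⟩
    · rintro ⟨h | h, h'⟩
      · exact absurd h h'
      · exact h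
  rcases G.cyclicOrderings.eq_empty_or_nonempty with h0 | ⟨l₀, hl₀⟩
  · simp [h0]
  have : Nonempty G.Subgraph := ⟨(hex l₀ hl₀).choose⟩
  choose! f hf hf' using hex
  have hfin : S.Finite := Set.toFinite S
  calc G.cyclicOrderings.card ≤
      (hfin.toFinset ×ˢ (Finset.univ : Finset (Option V × Option V))).card := by
        -- The pairs of the ordering are the edges of its cycle without the one joining the two
        -- ends, so cycle and ends determine it.
        refine Finset.card_le_card_of_injOn (fun l => (f l, (l.head?, l.getLast?))) ?_ ?_
        · intro l hl
          simp only [Finset.coe_product, Set.mem_prod, Finset.mem_coe, Set.Finite.mem_toFinset,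
            Finset.mem_univ, and_true]
          exact hf l hl
        · intro l hl l' hl' heq
          simp only [Prod.mk.injEq] at heq
          obtain ⟨h1, h2, h3⟩ := heq
          rw [Finset.mem_coe] at hl hl'
          have e1 := hf' l hl
          have e2 := hf' l' hl'
          rw [cyclicOrderings, Finset.mem_filter] at hl hl'
          obtain ⟨hlo, -, u, hu, v, hv, -⟩ := hl
          refine List.eq_of_head_eq_of_pathEdges_eq (mem_orderings.1 hlo).1
            (mem_orderings.1 hl'.1).1 h2 ?_
          ext e
          rw [e1 u v hu hv, e2 u v (h2 ▸ hu) (h3 ▸ hv), h1]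
    _ = _ := by
        rw [numHamiltonCycles, Set.ncard_eq_toFinset_card _ hfin]
        simp [Finset.card_product, sq]

end SimpleGraph

/-! ### Expander mixing for almost regular graphs -/

namespace SimpleGraph

variable {V : Type*} [DecidableEq V] [Fintype V] {G : SimpleGraph V} [DecidableRel G.Adj]

open scoped Matrix in
/-- An orthonormal eigenbasis of the adjacency matrix, in coordinates. -/
lemma NontrivialEigenvaluesLE.exists_basis {lam : ℝ} (h : G.NontrivialEigenvaluesLE lam)
    (hn : 0 < Fintype.card V) :
    ∃ (U : V → V → ℝ) (ev : V → ℝ) (i₀ : V), (∀ i, i ≠ i₀ → |ev i| ≤ lam) ∧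
      (∀ x y : V → ℝ, ∑ i, (U i ⬝ᵥ x) * (U i ⬝ᵥ y) = x ⬝ᵥ y) ∧
      ∀ i (x : V → ℝ), U i ⬝ᵥ (G.adjMatrix ℝ *ᵥ x) = ev i * (U i ⬝ᵥ x) := by
  set hA := G.isHermitian_adjMatrix ℝ
  -- `hA.eigenvalues` is `eigenvalues₀` transported along this equivalence, so `f 0` indexes the
  -- largest eigenvalue.
  set f : Fin (Fintype.card V) ≃ V := Fintype.equivOfCardEq (Fintype.card_fin _)
  refine ⟨fun i => (hA.eigenvectorBasis i).ofLp, hA.eigenvalues, f ⟨0, hn⟩, ?_, ?_, ?_⟩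
  · intro i hi
    refine h (f.symm i) fun h0 => hi ?_
    rw [← f.symm_apply_eq]
    exact Fin.ext h0
  · intro x y
    have := hA.eigenvectorBasis.sum_inner_mul_inner (WithLp.toLp 2 x) (WithLp.toLp 2 y)
    simp only [EuclideanSpace.inner_eq_star_dotProduct, star_trivial] at this
    rw [dotProduct_comm x y, ← this]
    refine Finset.sum_congr rfl fun i _ => ?_
    rw [dotProduct_comm _ y]
  · intro i x
    have hmul := hA.mulVec_eigenvectorBasis i
    rw [Matrix.dotProduct_mulVec, ← Matrix.mulVec_transpose, G.transpose_adjMatrix, hmul,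
      smul_dotProduct, smul_eq_mul]

open scoped Matrix in
lemma dotProduct_adjMatrix_mulVec_indicator (S T : Finset V) :
    (fun v => if v ∈ S then (1 : ℝ) else 0) ⬝ᵥ
      (G.adjMatrix ℝ *ᵥ fun v => if v ∈ T then (1 : ℝ) else 0) = (G.interedges S T).card := by
  rw [card_interedges_eq_sum]
  simp only [dotProduct, Matrix.mulVec, adjMatrix_apply, ite_mul, one_mul, zero_mul]
  push_cast
  rw [Finset.sum_ite_mem, Finset.univ_inter]
  refine Finset.sum_congr rfl fun v _ => ?_
  rw [← Finset.sum_filter, Finset.sum_ite_mem, Finset.sum_const, nsmul_one, Finset.filter_inter,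
    Finset.univ_inter]

lemma abs_degree_sub_avgDegree_le (v : V) :
    |(G.degree v : ℝ) - G.avgDegree| ≤ (G.maxDegree : ℝ) - G.minDegree := by
  have hn : (0 : ℝ) < Fintype.card V := by exact_mod_cast Fintype.card_pos_iff.2 ⟨v⟩
  have h1 : G.avgDegree ≤ G.maxDegree := by
    rw [avgDegree, div_le_iff₀ hn]
    calc _ ≤ ∑ _v : V, (G.maxDegree : ℝ) :=
          Finset.sum_le_sum fun w _ => by exact_mod_cast G.degree_le_maxDegree w
      _ = _ := by simp [mul_comm]
  have h2 : (G.minDegree : ℝ) ≤ G.avgDegree := by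
    rw [avgDegree, le_div_iff₀ hn]
    calc _ = ∑ _v : V, (G.minDegree : ℝ) := by simp [mul_comm]
      _ ≤ _ := Finset.sum_le_sum fun w _ => by exact_mod_cast G.minDegree_le_degree w
  have h3 : (G.degree v : ℝ) ≤ G.maxDegree := by exact_mod_cast G.degree_le_maxDegree v
  have h4 : (G.minDegree : ℝ) ≤ G.degree v := by exact_mod_cast G.minDegree_le_degree v
  rw [abs_le]
  constructor <;> linarith

lemma abs_sum_mul_le_sqrt {ι : Type*} (s : Finset ι) (f g : ι → ℝ) {F H : ℝ}
    (hf : ∑ i ∈ s, f i ^ 2 ≤ F) (hg : ∑ i ∈ s, g i ^ 2 ≤ H) :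
    |∑ i ∈ s, f i * g i| ≤ √F * √H := by
  have hf0 : 0 ≤ ∑ i ∈ s, f i ^ 2 := Finset.sum_nonneg fun _ _ => sq_nonneg _
  have hg0 : 0 ≤ ∑ i ∈ s, g i ^ 2 := Finset.sum_nonneg fun _ _ => sq_nonneg _
  rw [← Real.sqrt_mul (hf0.trans hf)]
  refine Real.abs_le_sqrt ((Finset.sum_mul_sq_le_sq_mul_sq s f g).trans ?_)
  exact mul_le_mul hf hg hg0 (hf0.trans hf)

/-- The numerical estimate behind the mixing lemma: `X, Y, a` are the coordinates of two indicator
vectors and of the all-ones vector along the leading eigenvector, the other quantities come from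
the orthogonal complement. -/
lemma mixing_estimate {d n lam R κ s t e X Y a P Q E α p q : ℝ} (hd : 0 < d) (hn : 0 < n)
    (hκ0 : 0 ≤ κ) (hκ2 : κ ≤ 1 / 2) (hdκ : d * κ = 2 * R * lam)
    (hs0 : 0 ≤ s) (ht0 : 0 ≤ t) (hX0 : |X| ≤ s) (hY0 : |Y| ≤ t) (ha0 : |a| ≤ √n)
    (hP : |P| ≤ s * (√n * κ)) (hQ : |Q| ≤ t * (√n * κ)) (hE1 : |E| ≤ lam * (s * t))
    (he0 : |e - d| ≤ 2 * R * lam) (hα0 : 0 ≤ α) (hα : α ≤ n * κ ^ 2) (haa : a ^ 2 + α = n)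
    (hXa : X * a + P = p) (hYa : Y * a + Q = q) :
    |e * (X * Y) + E - d * p * q / n| ≤ (1 + 8 * R) * lam * (s * t) := by
  have hrn : √n * √n = n := Real.mul_self_sqrt hn.le
  -- Expand p = Xa + P and q = Ya + Q and replace a² by n - α. The bounds `b1` to `b5` contribute
  -- 2R, R, 2R, 2R and R, in units of λst, and `E` contributes 1.
  have hid : e * (X * Y) + E - d * p * q / n =
      X * Y * (e - d) + X * Y * (d * α / n) + E - d / n * (X * a * Q)
        - d / n * (Y * a * P) - d / n * (P * Q) := by
    rw [← hXa, ← hYa]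
    have : a ^ 2 = n - α := by linarith
    field_simp
    linear_combination (-d * X * Y) * this
  have hst : |X * Y| ≤ s * t := by
    rw [abs_mul]; exact mul_le_mul hX0 hY0 (abs_nonneg _) hs0
  have b1 : |X * Y * (e - d)| ≤ s * t * (2 * R * lam) := by
    rw [abs_mul]; exact mul_le_mul hst he0 (abs_nonneg _) (by positivity)
  have b2 : |X * Y * (d * α / n)| ≤ s * t * (R * lam) := by
    rw [abs_mul]
    refine mul_le_mul hst ?_ (abs_nonneg _) (by positivity)
    rw [abs_of_nonneg (by positivity), div_le_iff₀ hn]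
    calc d * α ≤ d * (n * κ ^ 2) := by gcongr
      _ = (d * κ) * κ * n := by ring
      _ ≤ (d * κ) * (1 / 2) * n := by gcongr
      _ = _ := by rw [hdκ]; ring
  have b3 : |d / n * (X * a * Q)| ≤ s * t * (2 * R * lam) := by
    rw [abs_mul, abs_mul, abs_mul, abs_of_nonneg (show 0 ≤ d / n by positivity)]
    calc _ ≤ d / n * (s * √n * (t * (√n * κ))) := by gcongr
      _ = s * t * (d * κ) * ((√n * √n) / n) := by ring
      _ = _ := by rw [hrn, hdκ, div_self hn.ne', mul_one]
  have b4 : |d / n * (Y * a * P)| ≤ s * t * (2 * R * lam) := by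
    rw [abs_mul, abs_mul, abs_mul, abs_of_nonneg (show 0 ≤ d / n by positivity)]
    calc _ ≤ d / n * (t * √n * (s * (√n * κ))) := by gcongr
      _ = s * t * (d * κ) * ((√n * √n) / n) := by ring
      _ = _ := by rw [hrn, hdκ, div_self hn.ne', mul_one]
  have b5 : |d / n * (P * Q)| ≤ s * t * (R * lam) := by
    rw [abs_mul, abs_mul, abs_of_nonneg (show 0 ≤ d / n by positivity)]
    calc _ ≤ d / n * (s * (√n * κ) * (t * (√n * κ))) := by gcongr
      _ = s * t * ((d * κ) * κ) * ((√n * √n) / n) := by ring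
      _ = s * t * ((d * κ) * κ) := by rw [hrn, div_self hn.ne', mul_one]
      _ ≤ s * t * ((d * κ) * (1 / 2)) := by gcongr
      _ = _ := by rw [hdκ]; ring
  rw [hid]
  rw [abs_le] at b1 b2 b3 b4 b5 hE1 ⊢
  constructor <;> linarith

open scoped Matrix in
/-- Expander mixing for almost regular graphs. -/
theorem NontrivialEigenvaluesLE.mixing {lam R : ℝ} (h : G.NontrivialEigenvaluesLE lam)
    (hlam : 0 < lam) (hR : 0 < R)
    (hdeg : (G.maxDegree : ℝ) - G.minDegree ≤ R * lam) (hd2 : 2 * lam ≤ G.avgDegree)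
    (hdR : 4 * R * lam ≤ G.avgDegree) : G.Mixing G.avgDegree ((1 + 8 * R) * lam) := by
  intro S T
  set d := G.avgDegree
  have hd : 0 < d := by linarith
  have hnN : 0 < Fintype.card V := by
    by_contra hcon
    have h0 : Fintype.card V = 0 := by omega
    have : d = 0 := by simp only [d, avgDegree, h0]; simp
    linarith
  set n : ℝ := (Fintype.card V : ℝ) with hndef
  have hn : 0 < n := by rw [hndef]; exact_mod_cast hnN
  obtain ⟨U, ev, i₀, hev, hpars, heig⟩ := h.exists_basis hnN
  set x : V → ℝ := fun v => if v ∈ S then (1 : ℝ) else 0 with hx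
  set y : V → ℝ := fun v => if v ∈ T then (1 : ℝ) else 0 with hy
  set one : V → ℝ := fun _ => 1 with hone
  set r : V → ℝ := fun v => (G.degree v : ℝ) - d with hr
  have hxx : x ⬝ᵥ x = S.card := by simp [dotProduct, hx]
  have hyy : y ⬝ᵥ y = T.card := by simp [dotProduct, hy]
  have hx1 : x ⬝ᵥ one = S.card := by simp [dotProduct, hx, hone]
  have hy1 : y ⬝ᵥ one = T.card := by simp [dotProduct, hy, hone]
  have h11 : one ⬝ᵥ one = n := by simp [dotProduct, hone, hndef]
  have hrr : r ⬝ᵥ r ≤ n * (R * lam) ^ 2 := by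
    calc r ⬝ᵥ r = ∑ v, r v ^ 2 := by simp [dotProduct, sq]
      _ ≤ ∑ _v : V, (R * lam) ^ 2 := by
          refine Finset.sum_le_sum fun v _ => sq_le_sq' ?_ ?_
          · have := (abs_le.1 (G.abs_degree_sub_avgDegree_le v)).1
            simp only [hr]; linarith
          · have := (abs_le.1 (G.abs_degree_sub_avgDegree_le v)).2
            simp only [hr]; linarith
      _ = _ := by simp [hndef]
  have hA1 : G.adjMatrix ℝ *ᵥ one = r + d • one := by
    ext v
    simp [hr, hone, Matrix.mulVec, dotProduct, adjMatrix_apply,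
      ← card_neighborFinset_eq_degree, neighborFinset_eq_filter]
  set X : V → ℝ := fun i => U i ⬝ᵥ x with hX
  set Y : V → ℝ := fun i => U i ⬝ᵥ y with hY
  set a : V → ℝ := fun i => U i ⬝ᵥ one with ha
  set ρ : V → ℝ := fun i => U i ⬝ᵥ r with hρ
  -- These are the coordinates of A1 = d1 + r. For i ≠ i₀ the gap |ev i - d| ≥ d/2 makes the `a i`
  -- small, so the all-ones vector is nearly a leading eigenvector; at i₀, where |a| ≥ √n/2, it
  -- follows that ev i₀ is close to d.
  have hρa : ∀ i, (ev i - d) * a i = ρ i := by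
    intro i
    have := heig i one
    rw [hA1, dotProduct_add, dotProduct_smul, smul_eq_mul] at this
    simp only [ha, hρ]
    linarith
  have hsplit : ∀ f : V → ℝ, ∑ i, f i = f i₀ + ∑ i ∈ Finset.univ.erase i₀, f i := fun f =>
    (Finset.add_sum_erase _ f (Finset.mem_univ i₀)).symm
  have hXX : X i₀ ^ 2 + ∑ i ∈ Finset.univ.erase i₀, X i ^ 2 = S.card := by
    rw [← hsplit fun i => X i ^ 2, ← hxx, ← hpars x x]
    exact Finset.sum_congr rfl fun i _ => sq _
  have hYY : Y i₀ ^ 2 + ∑ i ∈ Finset.univ.erase i₀, Y i ^ 2 = T.card := by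
    rw [← hsplit fun i => Y i ^ 2, ← hyy, ← hpars y y]
    exact Finset.sum_congr rfl fun i _ => sq _
  have haa : a i₀ ^ 2 + ∑ i ∈ Finset.univ.erase i₀, a i ^ 2 = n := by
    rw [← hsplit fun i => a i ^ 2, ← h11, ← hpars one one]
    exact Finset.sum_congr rfl fun i _ => sq _
  have hρρ : ρ i₀ ^ 2 + ∑ i ∈ Finset.univ.erase i₀, ρ i ^ 2 ≤ n * (R * lam) ^ 2 := by
    rw [← hsplit fun i => ρ i ^ 2]
    refine le_trans (le_of_eq ?_) hrr
    rw [← hpars r r]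
    exact Finset.sum_congr rfl fun i _ => sq _
  have hXa : X i₀ * a i₀ + ∑ i ∈ Finset.univ.erase i₀, X i * a i = S.card := by
    rw [← hsplit fun i => X i * a i, ← hx1, ← hpars x one]
  have hYa : Y i₀ * a i₀ + ∑ i ∈ Finset.univ.erase i₀, Y i * a i = T.card := by
    rw [← hsplit fun i => Y i * a i, ← hy1, ← hpars y one]
  have hE : ev i₀ * (X i₀ * Y i₀) + ∑ i ∈ Finset.univ.erase i₀, X i * (ev i * Y i) =
      (G.interedges S T).card := by
    rw [← dotProduct_adjMatrix_mulVec_indicator, ← hpars,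
      hsplit fun i => (U i ⬝ᵥ x) * (U i ⬝ᵥ (G.adjMatrix ℝ *ᵥ y)), heig i₀ y]
    congr 1
    · simp only [hX, hY]; ring
    · exact Finset.sum_congr rfl fun i _ => by rw [heig i y]
  set κ := 2 * R * lam / d with hκ
  have hκ0 : 0 ≤ κ := by positivity
  have hκ2 : κ ≤ 1 / 2 := by rw [hκ, div_le_iff₀ hd]; linarith
  have hdκ : d * κ = 2 * R * lam := by rw [hκ]; field_simp
  set s := √(S.card : ℝ) with hs
  set t := √(T.card : ℝ) with ht
  have hs0 : 0 ≤ s := Real.sqrt_nonneg _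
  have ht0 : 0 ≤ t := Real.sqrt_nonneg _
  have hrn0 : 0 < √n := Real.sqrt_pos.2 hn
  have hnn : ∀ f : V → ℝ, 0 ≤ ∑ i ∈ Finset.univ.erase i₀, f i ^ 2 :=
    fun f => Finset.sum_nonneg fun _ _ => sq_nonneg _
  have hα : ∑ i ∈ Finset.univ.erase i₀, a i ^ 2 ≤ n * κ ^ 2 := by
    have h1 : ∑ i ∈ Finset.univ.erase i₀, a i ^ 2 * (d / 2) ^ 2 ≤ n * (R * lam) ^ 2 := by
      refine le_trans (Finset.sum_le_sum fun i hi => ?_)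
        ((le_add_of_nonneg_left (sq_nonneg (ρ i₀))).trans hρρ)
      rw [← hρa i, mul_pow, mul_comm]
      refine mul_le_mul_of_nonneg_right ?_ (sq_nonneg _)
      rw [← neg_sub, neg_sq]
      have := (abs_le.1 (hev i (Finset.ne_of_mem_erase hi))).2
      refine pow_le_pow_left₀ (by positivity) (by linarith) 2
    rw [← Finset.sum_mul] at h1
    rw [← le_div_iff₀ (by positivity)] at h1
    refine h1.trans (le_of_eq ?_)
    rw [hκ]
    field_simp
  have hsqrtα : √(n * κ ^ 2) = √n * κ := by
    rw [Real.sqrt_mul hn.le, Real.sqrt_sq hκ0]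
  have hX0 : |X i₀| ≤ s := Real.abs_le_sqrt (by linarith [hnn X])
  have hY0 : |Y i₀| ≤ t := Real.abs_le_sqrt (by linarith [hnn Y])
  have ha0 : |a i₀| ≤ √n := Real.abs_le_sqrt (by linarith [hnn a])
  have hP : |∑ i ∈ Finset.univ.erase i₀, X i * a i| ≤ s * (√n * κ) := by
    rw [← hsqrtα]
    exact abs_sum_mul_le_sqrt _ _ _ (by linarith [sq_nonneg (X i₀)]) hα
  have hQ : |∑ i ∈ Finset.univ.erase i₀, Y i * a i| ≤ t * (√n * κ) := by
    rw [← hsqrtα]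
    exact abs_sum_mul_le_sqrt _ _ _ (by linarith [sq_nonneg (Y i₀)]) hα
  have hE1 : |∑ i ∈ Finset.univ.erase i₀, X i * (ev i * Y i)| ≤ lam * (s * t) := by
    have : √(lam ^ 2 * T.card) = lam * t := by
      rw [Real.sqrt_mul (sq_nonneg _), Real.sqrt_sq hlam.le]
    calc _ ≤ s * √(lam ^ 2 * T.card) := by
          refine abs_sum_mul_le_sqrt _ _ _ (by linarith [sq_nonneg (X i₀)]) ?_
          calc _ ≤ ∑ i ∈ Finset.univ.erase i₀, lam ^ 2 * Y i ^ 2 := by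
                refine Finset.sum_le_sum fun i hi => ?_
                rw [mul_pow]
                refine mul_le_mul_of_nonneg_right ?_ (sq_nonneg _)
                rw [← sq_abs]
                exact pow_le_pow_left₀ (abs_nonneg _) (hev i (Finset.ne_of_mem_erase hi)) 2
            _ = lam ^ 2 * ∑ i ∈ Finset.univ.erase i₀, Y i ^ 2 := by rw [Finset.mul_sum]
            _ ≤ _ := mul_le_mul_of_nonneg_left (by linarith [sq_nonneg (Y i₀)]) (sq_nonneg _)
      _ = _ := by rw [this]; ring
  have he0 : |ev i₀ - d| ≤ 2 * R * lam := by
    have h1 : (√n / 2) ≤ |a i₀| := by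
      rw [← Real.sqrt_sq_eq_abs]
      refine Real.le_sqrt_of_sq_le ?_
      rw [div_pow, Real.sq_sqrt hn.le]
      have : n * κ ^ 2 ≤ n * (1 / 2) ^ 2 := by gcongr
      linarith
    have h2 : |ρ i₀| ≤ √n * (R * lam) := by
      have := Real.abs_le_sqrt (show ρ i₀ ^ 2 ≤ n * (R * lam) ^ 2 by linarith [hnn ρ])
      rwa [Real.sqrt_mul hn.le, Real.sqrt_sq (by positivity)] at this
    rw [← hρa i₀, abs_mul] at h2
    have h3 : |ev i₀ - d| * (√n / 2) ≤ √n * (R * lam) :=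
      (mul_le_mul_of_nonneg_left h1 (abs_nonneg _)).trans h2
    refine le_of_mul_le_mul_right ?_ (half_pos hrn0)
    linarith
  have hsqrt : √((S.card : ℝ) * T.card) = s * t := Real.sqrt_mul (Nat.cast_nonneg _) _
  rw [hsqrt, ← hE]
  exact mixing_estimate hd hn hκ0 hκ2 hdκ hs0 ht0 hX0 hY0 ha0 hP hQ hE1 he0 (hnn a) hα haa
    hXa hYa

end SimpleGraph

/-! ### Non-asymptotic bounds on the number of Hamilton cycles -/

namespace SimpleGraph

variable {V : Type*} [DecidableEq V] [Fintype V] {G : SimpleGraph V} [DecidableRel G.Adj]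
  {d μ : ℝ}

lemma prod_Ioc_mul_factorial (f : ℝ) {m n : ℕ} (hmn : m ≤ n) :
    (∏ i ∈ Finset.Ioc m n, f * (i : ℝ)) * (m ! : ℝ) = f ^ (n - m) * (n ! : ℝ) := by
  induction n, hmn using Nat.le_induction with
  | base => simp
  | succ n hmn ih =>
    rw [Finset.prod_Ioc_succ_top (by omega), Nat.factorial_succ, Nat.succ_sub hmn, pow_succ]
    push_cast at ih ⊢
    linear_combination (f * ((n : ℝ) + 1)) * ih

/-- Lower bound on the number of Hamilton cycles. -/
lemma Mixing.le_numHamiltonCycles (h : G.Mixing d μ) (hμ : 0 < μ) (hd : 0 < d)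
    (hdn : d ≤ Fintype.card V) {T b : ℕ}
    (hT : Fintype.card V ≤ 2 ^ T) (hb : 9 ≤ b) (hbn : (2 * T + 2) * b ≤ Fintype.card V)
    (hdb : 57 * (2 * T + 2) * μ * Fintype.card V ≤ d * b)
    (hdeg : ∀ v, d / 4 ≤ G.degree v) {m : ℕ} (hmn : m ≤ Fintype.card V) {θ : ℝ} (hθ1 : θ ≤ 1)
    (hθ0 : 0 ≤ θ) (hθ : μ + 1 ≤ θ * (d * m / Fintype.card V)) :
    ((Fintype.card V)! : ℝ) * (d / Fintype.card V) ^ Fintype.card V * (1 - θ) ^ Fintype.card V ≤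
      G.numHamiltonCycles * ((Fintype.card V : ℝ) + 1) ^ ((m + 1) * (16 * T + 7)) := by
  have hnN : 3 ≤ Fintype.card V := by nlinarith
  have hclose := exists_cyclicOrdering (G := G) (c := 4 * T)
    (fun l hl => h.exists_adj_ends hμ hd hT hb hbn hdb hdeg (mem_orderings.1 hl).1
      (mem_orderings.1 hl).2) m
  have h1 := card_pathFamilies_le_mul (G := G) m
  have h2 := card_le_of_close (P := (orderings V).filter fun l => (G.badEdges l).card ≤ m)
    (Q := G.cyclicOrderings) (Finset.filter_subset _ _) (Finset.filter_subset _ _)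
    (k := (m + 1) * (4 * T + 1)) (fun l hl => by
      rw [Finset.mem_filter] at hl
      exact hclose l hl.1 hl.2)
  have h3 := card_cyclicOrderings_le (G := G) hnN
  have h4 := h.le_card_pathFamilies (m := m) hd.le
    (hθ.trans (mul_le_of_le_one_left (by positivity) hθ1)) hmn
  set n := Fintype.card V with hn
  have hn0 : (0 : ℝ) < n := by exact_mod_cast (by omega : 0 < n)
  set k := (m + 1) * (4 * T + 1) with hk
  have hsq : n ^ 2 + 1 ≤ (n + 1) ^ 2 := by nlinarith
  -- Powers of n + 1: two for the ends of a cyclic ordering, 1 + 4k for closeness, `m` for the path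
  -- lengths and `m` for `m !`.
  have hupper : (G.pathFamilies m).card * m ! ≤
      G.numHamiltonCycles * (n + 1) ^ ((m + 1) * (16 * T + 7)) := by
    have hfac : m ! ≤ (n + 1) ^ m := (Nat.factorial_le_pow m).trans (by gcongr; omega)
    calc _ ≤ (G.numHamiltonCycles * (n + 1) ^ 2 * ((n + 1) * (((n + 1) ^ 2) ^ k) ^ 2) *
          (n + 1) ^ m) * (n + 1) ^ m := by
          refine Nat.mul_le_mul (h1.trans ?_) hfac
          refine Nat.mul_le_mul_right _ (h2.trans ?_)
          refine Nat.mul_le_mul h3 (Nat.mul_le_mul_left _ ?_)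
          gcongr
      _ = G.numHamiltonCycles * (n + 1) ^ (3 + 2 * m + 4 * k) := by
          rw [← pow_mul, ← pow_mul]; ring
      _ ≤ _ := by
          gcongr
          · omega
          · rw [hk]; nlinarith
  have hlower : (∏ i ∈ Finset.Ioc m n, ((1 - θ) * (d / n)) * (i : ℝ)) ≤
      (G.pathFamilies m).card := by
    refine le_trans ?_ h4
    have hch : (1 : ℝ) ≤ n.choose m := by exact_mod_cast Nat.choose_pos hmn
    have hstep : ∀ i ∈ Finset.Ioc m n, ((1 - θ) * (d / n)) * (i : ℝ) ≤ d * i / n - (μ + 1) := by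
      intro i hi
      have him : (m : ℝ) ≤ i := by exact_mod_cast (Finset.mem_Ioc.1 hi).1.le
      have : θ * (d * m / n) ≤ θ * (d * i / n) := by gcongr
      have e : ((1 - θ) * (d / n)) * (i : ℝ) = d * i / n - θ * (d * i / n) := by ring
      rw [e]; linarith
    have h0 : ∀ i ∈ Finset.Ioc m n, 0 ≤ ((1 - θ) * (d / n)) * (i : ℝ) := by
      intro i _
      have : 0 ≤ 1 - θ := by linarith
      positivity
    have hprod := Finset.prod_le_prod h0 hstep
    exact hprod.trans (le_mul_of_one_le_left ((Finset.prod_nonneg h0).trans hprod) hch)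
  -- The base is at most 1, so the `m` missing factors only help.
  have hfin : ((1 - θ) * (d / n)) ^ n * (n ! : ℝ) ≤ ((1 - θ) * (d / n)) ^ (n - m) * (n ! : ℝ) := by
    have h0 : 0 ≤ 1 - θ := by linarith
    have hdn1 : d / n ≤ 1 := by rw [div_le_one hn0]; exact hdn
    refine mul_le_mul_of_nonneg_right ?_ (by positivity)
    exact pow_le_pow_of_le_one (by positivity)
      (mul_le_one₀ (by linarith) (by positivity) hdn1) (Nat.sub_le _ _)
  calc _ = ((1 - θ) * (d / n)) ^ n * (n ! : ℝ) := by rw [mul_pow]; ring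
    _ ≤ _ := hfin
    _ = (∏ i ∈ Finset.Ioc m n, ((1 - θ) * (d / n)) * (i : ℝ)) * (m ! : ℝ) :=
        (prod_Ioc_mul_factorial _ hmn).symm
    _ ≤ (G.pathFamilies m).card * (m ! : ℝ) := by gcongr
    _ ≤ _ := by exact_mod_cast hupper

lemma prod_Ioc_add_le_ascFactorial (c : ℕ) {n : ℕ} (hn : 1 ≤ n) :
    ∏ i ∈ Finset.Ioc 1 n, ((i : ℝ) + c) ≤ ((c + 1).ascFactorial n : ℝ) := by
  induction n, hn using Nat.le_induction with
  | base => simp [Nat.ascFactorial_succ]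
  | succ n hn ih =>
    rw [Finset.prod_Ioc_succ_top (by omega), Nat.ascFactorial_succ, mul_comm]
    push_cast
    have e : (n : ℝ) + 1 + c = c + 1 + n := by ring
    rw [e]
    gcongr

/-- Upper bound on the number of Hamilton cycles. -/
lemma Mixing.numHamiltonCycles_le (h : G.Mixing d μ) (hμ : 0 ≤ μ) (hd : 1 ≤ d)
    (hn : 0 < Fintype.card V) {c : ℕ} (hc : μ * Fintype.card V ≤ c * d)
    (hcn : c ≤ Fintype.card V) :
    (G.numHamiltonCycles : ℝ) ≤ ((Fintype.card V)! : ℝ) * (d / Fintype.card V) ^ Fintype.card V *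
      (2 * Fintype.card V) ^ (c + 2) := by
  have h1 : (G.numHamiltonCycles : ℝ) ≤ (G.pathFamilies 1).card := by
    exact_mod_cast SimpleGraph.numHamiltonCycles_le (G := G)
  have h2 := h.card_pathFamilies_le (by linarith) hμ (j := 1) (by omega)
  set n := Fintype.card V
  have hn0 : (0 : ℝ) < n := by exact_mod_cast hn
  have hn1 : (1 : ℝ) ≤ n := by exact_mod_cast hn
  -- Since μ ≤ (d/n)c, each factor is at most (d/n)(i + c), and the product is dominated by the
  -- rising factorial n! C(n+c, c).
  have h3 : ∏ i ∈ Finset.Ioc 1 n, (d * i / n + μ) ≤ (d / n) ^ (n - 1) *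
      ((c + 1).ascFactorial n : ℝ) := by
    calc _ ≤ ∏ i ∈ Finset.Ioc 1 n, (d / n) * ((i : ℝ) + c) := by
          refine Finset.prod_le_prod (fun i _ => by positivity) fun i _ => ?_
          have : μ ≤ d / n * c := by
            rw [div_mul_eq_mul_div, le_div_iff₀ hn0]; linarith
          calc d * i / n + μ ≤ d * i / n + d / n * c := by gcongr
            _ = _ := by ring
      _ = (d / n) ^ (n - 1) * ∏ i ∈ Finset.Ioc 1 n, ((i : ℝ) + c) := by
          rw [Finset.prod_mul_distrib, Finset.prod_const, Nat.card_Ioc]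
      _ ≤ _ := by
          gcongr
          exact prod_Ioc_add_le_ascFactorial c hn
  have h4 : ((c + 1).ascFactorial n : ℝ) ≤ n ! * (2 * n) ^ c := by
    have : (c + 1).ascFactorial n ≤ n ! * (2 * n) ^ c := by
      rw [Nat.ascFactorial_eq_factorial_mul_choose, ← Nat.choose_symm_add]
      refine Nat.mul_le_mul_left _ ((Nat.choose_le_pow _ _).trans ?_)
      gcongr
      omega
    exact_mod_cast this
  have h5 : (d / n) ^ (n - 1) ≤ (d / n) ^ n * n := by
    obtain ⟨k, hk⟩ : ∃ k, n = k + 1 := ⟨n - 1, by omega⟩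
    have e : (d / n) ^ n * n = (d / n) ^ (n - 1) * d := by
      rw [hk, Nat.add_sub_cancel, pow_succ, ← hk]
      field_simp
    rw [e]
    exact le_mul_of_one_le_right (by positivity) hd
  rw [Nat.choose_one_right] at h2
  calc (G.numHamiltonCycles : ℝ) ≤ n * ((d / n) ^ (n - 1) * ((c + 1).ascFactorial n : ℝ)) :=
        h1.trans (h2.trans (by gcongr))
    _ ≤ n * ((d / n) ^ n * n * (n ! * (2 * n) ^ c)) := by gcongr
    _ = (n ! : ℝ) * (d / n) ^ n * ((2 * n) ^ c * n ^ 2) := by ring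
    _ ≤ (n ! : ℝ) * (d / n) ^ n * ((2 * n) ^ c * (2 * n) ^ 2) := by gcongr; linarith
    _ = _ := by rw [← pow_add]

end SimpleGraph

/-! ### Choice of parameters and error terms -/

namespace SimpleGraph

variable {V : Type*} [DecidableEq V] [Fintype V] {G : SimpleGraph V} [DecidableRel G.Adj]
  {d μ : ℝ}

lemma avgDegree_le_card : G.avgDegree ≤ Fintype.card V := by
  rcases Nat.eq_zero_or_pos (Fintype.card V) with h0 | hpos
  · simp [avgDegree, h0]
  have hn : (0 : ℝ) < Fintype.card V := by exact_mod_cast hpos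
  rw [avgDegree, div_le_iff₀ hn]
  calc _ ≤ ∑ _v : V, (Fintype.card V : ℝ) :=
        Finset.sum_le_sum fun v _ => by exact_mod_cast (G.degree_lt_card_verts v).le
    _ = _ := by simp

/-- For an edge uv, the pairs ({u},{u}) and ({u},{v}) span 0 and 1 edges but have the same main term
d/n. This gives μ + 1 ≤ 3μ below. -/
lemma Mixing.one_le_two_mul (h : G.Mixing G.avgDegree μ) (hd : 0 < G.avgDegree) : 1 ≤ 2 * μ := by
  obtain ⟨u, v, huv⟩ : ∃ u v, G.Adj u v := by
    by_contra! hcon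
    have : ∀ v, G.degree v = 0 := fun v => by
      rw [← G.card_neighborFinset_eq_degree, Finset.card_eq_zero, neighborFinset_eq_filter,
        Finset.filter_false_of_mem fun w _ => hcon v w]
    simp [avgDegree, this] at hd
  have h1 := h {u} {u}
  have h2 := h {u} {v}
  simp only [card_interedges_eq_sum, Finset.sum_singleton, Finset.filter_singleton, G.irrefl, huv,
    if_true, if_false, Finset.card_singleton, Finset.card_empty, Nat.cast_one, Nat.cast_zero,
    mul_one, Real.sqrt_one] at h1 h2
  rw [abs_le] at h1 h2
  linarith [h1.1, h2.2]

lemma clog_two_le {n : ℕ} (h : 1 ≤ Real.log n) : (Nat.clog 2 n : ℝ) ≤ 3 * Real.log n := by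
  have hn : 1 < n := by
    by_contra hcon
    have : n = 0 ∨ n = 1 := by omega
    rcases this with rfl | rfl <;> norm_num at h
  have h1 := Nat.pow_pred_clog_lt_self (b := 2) (by norm_num) hn
  have h2 : ((2 : ℝ) ^ (Nat.clog 2 n).pred) ≤ n := by exact_mod_cast h1.le
  have h3 := Real.log_le_log (by positivity) h2
  rw [Real.log_pow] at h3
  have h4 : (Nat.clog 2 n : ℝ) ≤ (Nat.clog 2 n).pred + 1 := by
    have : Nat.clog 2 n ≤ (Nat.clog 2 n).pred + 1 := by simp only [Nat.pred_eq_sub_one]; omega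
    exact_mod_cast this
  have h5 := Real.log_two_gt_d9
  have h6 : (0 : ℝ) ≤ (Nat.clog 2 n).pred := by positivity
  nlinarith

lemma pow_le_exp_pow {x w : ℝ} {c n : ℕ} (hx : 0 < x) (h : c * Real.log x ≤ n * w) :
    x ^ c ≤ Real.exp w ^ n := by
  rw [← Real.exp_nat_mul, ← Real.exp_log (pow_pos hx c), Real.log_pow]
  exact Real.exp_le_exp.2 h

/-- Two-sided bound on the number of Hamilton cycles, with all errors in terms of
`ρ = μ log² n / d`. -/
lemma Mixing.numHamiltonCycles_bounds {n : ℕ} {ρ : ℝ} (h : G.Mixing d μ)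
    (hcard : Fintype.card V = n) (hμ : 1 ≤ 2 * μ) (hd : 0 < d) (hdn : d ≤ n)
    (hdeg : ∀ v, d / 4 ≤ G.degree v) (hlog : 1 ≤ Real.log n) (hn : 72 * Real.log n ≤ n)
    (hρd : μ * Real.log n ^ 2 = ρ * d) (hρ : ρ ≤ 1 / 7296) :
    (n ! : ℝ) * (d / n) ^ n * ((1 - 3 * √ρ) *
        Real.exp (-(110 * √ρ + 220 * (Real.log n ^ 2 / n)))) ^ n ≤ G.numHamiltonCycles ∧
      (G.numHamiltonCycles : ℝ) ≤ (n ! : ℝ) * (d / n) ^ n *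
        Real.exp (2 * ρ + 6 * (Real.log n / n)) ^ n := by
  set ℓ := Real.log n with hℓ
  have hn0 : (0 : ℝ) < n := by linarith
  have hn2 : 2 ≤ n := by
    have : (2 : ℝ) ≤ n := by linarith
    exact_mod_cast this
  have hn2r : (2 : ℝ) ≤ n := by exact_mod_cast hn2
  have hμ0 : 0 < μ := by linarith
  have hρ0 : 0 < ρ := by
    have : 0 < ρ * d := by rw [← hρd]; positivity
    exact pos_of_mul_pos_left this hd.le
  have hsρ : 0 < √ρ := Real.sqrt_pos.2 hρ0
  have hsρρ : √ρ * √ρ = ρ := Real.mul_self_sqrt hρ0.le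
  have hsρ1 : √ρ ≤ 1 / 80 := by
    rw [Real.sqrt_le_left (by norm_num)]
    linarith
  have hlog2 : Real.log (n + 1) ≤ 2 * ℓ := by
    rw [hℓ, ← Real.log_rpow hn0]
    refine Real.log_le_log (by positivity) ?_
    norm_cast
    nlinarith
  have hlog2' : Real.log (2 * n) ≤ 2 * ℓ := by
    rw [hℓ, ← Real.log_rpow hn0]
    refine Real.log_le_log (by positivity) ?_
    norm_cast
    nlinarith
  constructor
  · set T := Nat.clog 2 n with hTdef
    have hT3 : (T : ℝ) ≤ 3 * ℓ := clog_two_le hlog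
    have hT : n ≤ 2 ^ T := Nat.le_pow_clog (by norm_num) n
    set M := 2 * T + 2 with hM
    have hMr : (M : ℝ) = 2 * T + 2 := by rw [hM]; push_cast; ring
    have hM8 : (M : ℝ) ≤ 8 * ℓ := by rw [hMr]; linarith
    have hMpos : (0 : ℝ) < M := by rw [hMr]; positivity
    set b := n / M with hb
    have h9M : 9 * M ≤ n := by
      have : (9 : ℝ) * M ≤ n := by linarith
      exact_mod_cast this
    have hb9 : 9 ≤ b := (Nat.le_div_iff_mul_le (by omega)).2 h9M
    have hbM : M * b ≤ n := Nat.mul_div_le n M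
    have hbM' : (n : ℝ) ≤ 2 * M * b := by
      have h1 : n < M * b + M := Nat.lt_mul_div_succ n (by omega : 0 < M) |>.trans_eq (by ring)
      have h2 : M ≤ M * b := Nat.le_mul_of_pos_right M (by omega)
      have : n ≤ 2 * (M * b) := by omega
      have : (n : ℝ) ≤ 2 * (M * b) := by exact_mod_cast this
      linarith
    -- Using b ≥ n/(2M), it suffices that 114M²μ ≤ d; as M ≤ 8ℓ, this follows from 7296μℓ² ≤ d,
    -- whence the bound on ρ.
    have hdb : 57 * (2 * (T : ℝ) + 2) * μ * n ≤ d * b := by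
      rw [← hMr]
      have h1 : 114 * (M : ℝ) ^ 2 * μ ≤ d := by
        calc 114 * (M : ℝ) ^ 2 * μ ≤ 114 * (8 * ℓ) ^ 2 * μ := by gcongr
          _ = 7296 * (μ * ℓ ^ 2) := by ring
          _ = 7296 * ρ * d := by rw [hρd]; ring
          _ ≤ 1 * d := by gcongr; linarith
          _ = d := one_mul d
      calc 57 * (M : ℝ) * μ * n ≤ 57 * (M : ℝ) * μ * (2 * M * b) := by gcongr
        _ = 114 * (M : ℝ) ^ 2 * μ * b := by ring
        _ ≤ d * b := by gcongr
    -- This balances two losses: μ ≤ √ρ·dm/n allows θ = 3√ρ, while m·T·log n stays O(√ρ n + log² n).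
    set m := ⌈n * √ρ / ℓ ^ 2⌉₊ with hm
    have hm_ge : n * √ρ / ℓ ^ 2 ≤ m := Nat.le_ceil _
    have hm_le : (m : ℝ) ≤ n * √ρ / ℓ ^ 2 + 1 := (Nat.ceil_lt_add_one (by positivity)).le
    have hmn : m ≤ n := by
      rw [hm, Nat.ceil_le, div_le_iff₀ (by positivity)]
      have : 1 ≤ ℓ ^ 2 := one_le_pow₀ hlog
      nlinarith
    have hθ : μ + 1 ≤ 3 * √ρ * (d * m / n) := by
      have h1 : μ ≤ √ρ * (d * m / n) := by
        calc μ = √ρ * (d * (n * √ρ / ℓ ^ 2) / n) := by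
              have : μ = ρ * d / ℓ ^ 2 := by rw [← hρd]; field_simp
              rw [this]
              field_simp
              nlinarith
          _ ≤ _ := by gcongr
      linarith
    have hlow := h.le_numHamiltonCycles hμ0 hd (by rw [hcard]; exact hdn) (T := T) (b := b)
      (by rw [hcard]; exact hT) hb9 (by rw [hcard]; exact hbM) (by rw [hcard]; exact hdb) hdeg
      (m := m) (by rw [hcard]; exact hmn) (θ := 3 * √ρ) (by linarith) (by positivity)
      (by rw [hcard]; exact hθ)
    rw [hcard] at hlow
    -- 16T + 7 ≤ 55ℓ and log(n+1) ≤ 2ℓ give 110; rounding `m` up and the further +1 give 220.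
    have hexp : ((n : ℝ) + 1) ^ ((m + 1) * (16 * T + 7)) ≤
        Real.exp (110 * √ρ + 220 * (ℓ ^ 2 / n)) ^ n := by
      refine pow_le_exp_pow (by positivity) ?_
      push_cast
      calc ((m : ℝ) + 1) * (16 * T + 7) * Real.log (n + 1) ≤
          (n * √ρ / ℓ ^ 2 + 2) * (55 * ℓ) * (2 * ℓ) := by
            have h0 : 0 ≤ Real.log ((n : ℝ) + 1) := Real.log_nonneg (by linarith)
            refine mul_le_mul (mul_le_mul ?_ ?_ (by positivity) (by positivity)) hlog2 h0
              (by positivity)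
            · linarith
            · linarith
        _ = _ := by field_simp; ring
    rw [mul_pow, Real.exp_neg, inv_pow, ← mul_assoc, ← div_eq_mul_inv,
      div_le_iff₀ (by positivity)]
    exact hlow.trans (by gcongr)
  · set c := ⌈μ * n / d⌉₊ with hc
    have hμd : μ / d = ρ / ℓ ^ 2 := by
      rw [div_eq_div_iff hd.ne' (by positivity)]; exact hρd
    have hc_ge : μ * n / d ≤ c := Nat.le_ceil _
    have hc_le : (c : ℝ) ≤ ρ * n / ℓ ^ 2 + 1 := by
      refine (Nat.ceil_lt_add_one (by positivity)).le.trans_eq ?_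
      rw [mul_div_right_comm, hμd]; ring
    have hl2 : 1 ≤ ℓ ^ 2 := one_le_pow₀ hlog
    have hd1 : μ ≤ d / 7296 := by
      have : μ ≤ ρ * d := by rw [← hρd]; exact le_mul_of_one_le_right hμ0.le hl2
      nlinarith
    have hd2 : 1 ≤ d := by linarith
    have hcn : c ≤ n := by
      rw [hc, Nat.ceil_le, div_le_iff₀ hd]
      nlinarith
    have hup := h.numHamiltonCycles_le hμ0.le hd2 (by rw [hcard]; omega) (c := c)
      (by rw [hcard]; rwa [div_le_iff₀ hd] at hc_ge) (by rw [hcard]; exact hcn)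
    rw [hcard] at hup
    refine hup.trans ?_
    gcongr
    refine pow_le_exp_pow (by positivity) ?_
    push_cast
    have h0 : 0 ≤ Real.log (2 * (n : ℝ)) := Real.log_nonneg (by linarith)
    calc ((c : ℝ) + 2) * Real.log (2 * n) ≤ (ρ * n / ℓ ^ 2 + 3) * (2 * ℓ) := by
          refine mul_le_mul ?_ hlog2' h0 (by positivity)
          linarith
      _ = 2 * (ρ * n) * (1 / ℓ) + 6 * ℓ := by field_simp; ring
      _ ≤ 2 * (ρ * n) * 1 + 6 * ℓ := by
          gcongr
          rw [div_le_one (by linarith)]; exact hlog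
      _ = _ := by field_simp

end SimpleGraph

/-! ### Passage to the limit -/

theorem theorem6
    (n : ℕ → ℕ) (hn : Tendsto n atTop atTop)
    (G : ∀ k, SimpleGraph (Fin (n k))) [∀ k, DecidableRel (G k).Adj]
    (lam : ℕ → ℝ) (hlam : ∀ k, (G k).NontrivialEigenvaluesLE (lam k))
    (R : ℝ) (hR : 0 < R)
    (h1 : ∀ k, ((G k).maxDegree : ℝ) - ((G k).minDegree : ℝ) ≤ R * lam k)
    (h2 : (fun k => Real.log (n k) ^ 2) =o[atTop] fun k => (G k).avgDegree / lam k)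
    (h3 : (fun k => Real.log (n k)) =o[atTop]
      fun k => Real.log (G k).avgDegree * Real.log ((G k).avgDegree / lam k)) :
    ∃ ε : ℕ → ℝ, Tendsto ε atTop (𝓝 0) ∧
      ∀ᶠ k in atTop, ((G k).numHamiltonCycles : ℝ) =
        ((n k)! : ℝ) * ((G k).avgDegree / (n k : ℝ)) ^ (n k) * (1 + ε k) ^ (n k) := by
  set d : ℕ → ℝ := fun k => (G k).avgDegree with hd
  set C : ℝ := 1 + 8 * R with hC
  have hC1 : 1 ≤ C := by linarith
  set ρ : ℕ → ℝ := fun k => C * (Real.log (n k) ^ 2 / (d k / lam k)) with hρdef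
  have hncast : Tendsto (fun k => (n k : ℝ)) atTop atTop := tendsto_natCast_atTop_atTop.comp hn
  have hρ : Tendsto ρ atTop (𝓝 0) := by
    have := h2.tendsto_div_nhds_zero.const_mul C
    rwa [mul_zero] at this
  have hsρ : Tendsto (fun k => √(ρ k)) atTop (𝓝 0) := by
    have := (Real.continuous_sqrt.tendsto 0).comp hρ
    rwa [Real.sqrt_zero] at this
  have hlogn : Tendsto (fun k => Real.log (n k)) atTop atTop := Real.tendsto_log_atTop.comp hncast
  have hl1 : Tendsto (fun k => Real.log (n k) / n k) atTop (𝓝 0) := by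
    have := Real.isLittleO_log_id_atTop.tendsto_div_nhds_zero.comp hncast
    exact this
  have hl2 : Tendsto (fun k => Real.log (n k) ^ 2 / n k) atTop (𝓝 0) := by
    have := (Real.isLittleO_pow_log_id_atTop (n := 2)).tendsto_div_nhds_zero.comp hncast
    exact this
  -- The choice is ε = Q^{1/n} - 1; since low^n ≤ Q ≤ up^n eventually, Q^{1/n} is squeezed to 1.
  set Q : ℕ → ℝ := fun k => (G k).numHamiltonCycles / (((n k)! : ℝ) * (d k / n k) ^ n k) with hQ
  set low : ℕ → ℝ := fun k => (1 - 3 * √(ρ k)) *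
    Real.exp (-(110 * √(ρ k) + 220 * (Real.log (n k) ^ 2 / n k))) with hlow
  set up : ℕ → ℝ := fun k => Real.exp (2 * ρ k + 6 * (Real.log (n k) / n k)) with hup
  have hlow1 : Tendsto low atTop (𝓝 1) := by
    have e1 : Tendsto (fun k => 1 - 3 * √(ρ k)) atTop (𝓝 (1 - 3 * 0)) :=
      (hsρ.const_mul 3).const_sub 1
    have e2 : Tendsto (fun k => Real.exp (-(110 * √(ρ k) + 220 * (Real.log (n k) ^ 2 / n k))))
        atTop (𝓝 (Real.exp (-(110 * 0 + 220 * 0)))) :=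
      (Real.continuous_exp.tendsto _).comp ((hsρ.const_mul 110).add (hl2.const_mul 220)).neg
    have := e1.mul e2
    rwa [mul_zero, mul_zero, mul_zero, add_zero, neg_zero, Real.exp_zero, sub_zero, mul_one] at this
  have hup1 : Tendsto up atTop (𝓝 1) := by
    have e2 : Tendsto up atTop (𝓝 (Real.exp (2 * 0 + 6 * 0))) :=
      (Real.continuous_exp.tendsto _).comp ((hρ.const_mul 2).add (hl1.const_mul 6))
    simpa using e2
  have hmain : ∀ᶠ k in atTop, 0 < n k ∧ 0 < ((n k)! : ℝ) * (d k / n k) ^ n k ∧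
      low k ^ n k ≤ Q k ∧ Q k ≤ up k ^ n k ∧ 0 ≤ low k := by
    -- The second bound yields (2 + 4R)λ ≤ d, which covers both requirements of the mixing lemma and
    -- the minimum degree condition.
    have hsmall : 0 < min (1 / 7296) (1 / (C * (2 + 4 * R))) := by positivity
    filter_upwards [hlogn.eventually_ge_atTop 1, hρ.eventually_lt_const hsmall,
      h2.bound one_pos, hl1.eventually_lt_const (show (0 : ℝ) < 1 / 72 by norm_num),
      hn.eventually_gt_atTop 0] with k hk1 hk2 hk3 hk4 hk5
    have hlam0 : 0 ≤ lam k := by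
      have h0 : 0 ≤ R * lam k := by
        refine le_trans ?_ (h1 k)
        rw [sub_nonneg]
        exact_mod_cast (G k).minDegree_le_maxDegree
      exact nonneg_of_mul_nonneg_right h0 hR
    have hlog2 : 1 ≤ Real.log (n k) ^ 2 := one_le_pow₀ hk1
    -- Division by zero has value 0, so this excludes λ = 0 as well as d = 0; either would force
    -- log² n ≤ 0.
    have hdlam : d k / lam k ≠ 0 := by
      intro h0
      simp only [hd] at h0
      rw [h0, norm_zero, mul_zero, Real.norm_eq_abs, abs_of_nonneg (by positivity)] at hk3
      linarith
    have hlamp : 0 < lam k := hlam0.lt_of_ne' fun h0 => hdlam (by rw [h0, div_zero])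
    have hd0 : 0 ≤ d k := by simp only [hd, SimpleGraph.avgDegree]; positivity
    have hdp : 0 < d k := hd0.lt_of_ne' fun h0 => hdlam (by rw [h0, zero_div])
    have hCp : 0 < C := by linarith
    have hρd : C * lam k * Real.log (n k) ^ 2 = ρ k * d k := by
      simp only [hρdef]
      field_simp
    have hbig : (2 + 4 * R) * lam k ≤ d k := by
      have h4 : ρ k ≤ 1 / (C * (2 + 4 * R)) := (hk2.trans_le (min_le_right _ _)).le
      have h5 : C * lam k * 1 ≤ 1 / (C * (2 + 4 * R)) * d k := by
        calc C * lam k * 1 ≤ C * lam k * Real.log (n k) ^ 2 := by gcongr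
          _ = ρ k * d k := hρd
          _ ≤ _ := by gcongr
      rw [div_mul_eq_mul_div, one_mul, le_div_iff₀ (by positivity)] at h5
      have h6 : 1 * ((2 + 4 * R) * lam k) ≤ (C * C) * ((2 + 4 * R) * lam k) := by
        gcongr
        nlinarith
      linarith
    have hRl : 0 < R * lam k := by positivity
    have hmix : (G k).Mixing (d k) (C * lam k) :=
      (hlam k).mixing hlamp hR (h1 k) (by linarith) (by linarith)
    have hnp : (0 : ℝ) < n k := by exact_mod_cast hk5
    have hdeg : ∀ v, d k / 4 ≤ (G k).degree v := by
      intro v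
      have h4 := (abs_le.1 ((G k).abs_degree_sub_avgDegree_le v)).1
      have h5 := h1 k
      change -_ ≤ _ - d k at h4
      linarith
    have hbase : 0 < ((n k)! : ℝ) * (d k / n k) ^ n k := by positivity
    have hρ' : ρ k ≤ 1 / 7296 := (hk2.trans_le (min_le_left _ _)).le
    obtain ⟨hlo, hhi⟩ := hmix.numHamiltonCycles_bounds (n := n k) (ρ := ρ k) (Fintype.card_fin _)
      (hmix.one_le_two_mul hdp) hdp
      (by simpa using (G k).avgDegree_le_card) hdeg hk1
      (by rw [div_lt_iff₀ hnp] at hk4; linarith) hρd hρ'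
    refine ⟨hk5, hbase, ?_, ?_, ?_⟩
    · rw [hQ, le_div_iff₀ hbase, mul_comm]
      exact hlo
    · rw [hQ, div_le_iff₀ hbase, mul_comm]
      exact hhi
    · refine mul_nonneg ?_ (Real.exp_pos _).le
      have : √(ρ k) ≤ 1 / 3 := by
        rw [Real.sqrt_le_left (by norm_num)]
        linarith
      linarith
  refine ⟨fun k => Q k ^ ((n k : ℝ)⁻¹) - 1, ?_, ?_⟩
  · have hlim : Tendsto (fun k => Q k ^ ((n k : ℝ)⁻¹)) atTop (𝓝 1) := by
      refine tendsto_of_tendsto_of_tendsto_of_le_of_le' hlow1 hup1 ?_ ?_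
      · filter_upwards [hmain] with k ⟨hk0, hk1, hk2, hk3, hk4⟩
        rw [← Real.pow_rpow_inv_natCast hk4 hk0.ne']
        exact Real.rpow_le_rpow (pow_nonneg hk4 _) hk2 (by positivity)
      · filter_upwards [hmain] with k ⟨hk0, hk1, hk2, hk3, hk4⟩
        rw [← Real.pow_rpow_inv_natCast (show 0 ≤ up k from (Real.exp_pos _).le) hk0.ne']
        exact Real.rpow_le_rpow ((pow_nonneg hk4 _).trans hk2) hk3 (by positivity)
    simpa using hlim.sub_const 1
  · filter_upwards [hmain] with k ⟨hk0, hk1, hk2, hk3, hk4⟩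
    rw [add_sub_cancel, Real.rpow_inv_natCast_pow ((pow_nonneg hk4 _).trans hk2) hk0.ne',
      mul_div_cancel₀ _ hk1.ne']
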